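/- Let $p$ be an odd prime, $\mathbb F$ a finite field of characteristic $p$, and $m\le p-1$ an odd positive integer. Let $V_m$ be the space of homogeneous polynomials of degree $m$ in $\mathbb F[X,Y]$, and let $\beta_m$ be the bilinear form on $V_m$ with $\beta_m(X^aY^b,X^cY^d)=(-1)^a/\binom ma$ if $a=d$ and $0$ otherwise (where $a+b=c+d=m$). Let $Q=V_m\times\mathbb F$ be the group with multiplication $(v,y)(w,z)=(v+w,\,y+z+\beta_m(v,w))$. For $A=\begin{pmatrix}\alpha&\beta\\\gamma&\delta\end{pmatrix}\in \mathrm{GL}_2(\mathbb F)$ let $v\mapsto v\cdot A$ be the substitution $X\mapsto\alpha X+\beta Y$, $Y\mapsto\gamma X+\delta Y$ on $V_m$. The group $L=\mathbb F^\times\times\mathrm{GL}_2(\mathbb F)$ acts on $Q$ from the right by $(v,z)^{(t,A)}=(t\,(v\cdot A),\,t^2(\det A)^m z)$; let $P=P(m,\mathbb F)=LQ$ be the semidirect product. Let $K\le\mathrm{SL}_3(\mathbb F)$ be the subgroup of all matrices of determinant $1$ with first row $(1,0,0)$, let $W=O_p(K)$ be its largest normal $p$-subgroup, and let $$C=\left\{\begin{pmatrix}1&0&0\\\alpha&\theta&0\\\delta&\varepsilon&\theta^{-1}\end{pmatrix}\;\middle|\;\alpha,\delta,\varepsilon\in\mathbb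 F,\ \theta\in\mathbb F^\times\right\}\le K .$$ (1) The group $P/C_L(Q)$ has a $p$-subgroup $W_0$ for which there is an isomorphism $N_{P/Z(P)}(W_0Z(P)/Z(P))\to C$ that maps $W_0Z(P)/Z(P)$ onto $W$, if and only if $|\mathbb F|=p$ and $p=m+4$. (Here $W_0Z(P)/Z(P)$ is the image in $P/Z(P)$ of the preimage of $W_0$ in $P$.) (2) Suppose that $|\mathbb F|=p$ and $p=m+4$. Put $w(\lambda)=\sum_{j=0}^m\frac{\lambda^{j+1}}{j+1}\binom mj X^jY^{m-j}$ for $\lambda\in\mathbb F$, and let $W_0$ be the subgroup of $P$ generated by the elements $\left(1,\begin{pmatrix}1&0\\\gamma&1\end{pmatrix}\right)(w(\gamma),\delta)$ with $\gamma,\delta\in\mathbb F$. Then $W_0$ is a $p$-group, $N_P(W_0)$ consists exactly of the elements $$\left(ab^{-m-1},\begin{pmatrix}a&0\\b\lambda&b\end{pmatrix}\right)(w(\lambda)+\tau X^m,\theta)\qquad(a,b\in\mathbb F^\times,\ \lambda,\tau,\theta\in\mathbb F),$$ and the map $\Theta$ that sends this element to $$\begin{pmatrix}1&0&0\\\frac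 ba\lambda&\frac ba&0\\\frac ab\left(\theta+\frac{\lambda^{m+2}}{(m+1)(m+2)}-\lambda\tau\right)&-2\frac ab\tau&\frac ab\end{pmatrix}$$ is a surjective homomorphism from $N_P(W_0)$ onto $C$ with kernel $C_L(Q)$. Moreover, $\Theta$ induces an isomorphism as in (1): there is an isomorphism $N_{P/Z(P)}(W_0Z(P)/Z(P))\to C$ that sends $xZ(P)$ to $\Theta(x)$ for all $x\in N_P(W_0)$ and maps $W_0Z(P)/Z(P)$ onto $W$. -/

import Mathlib

namespace BinaryAmalgam

open MvPolynomial

noncomputable section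

/-- `V_m`: homogeneous polynomials of degree `m` in `X = X 0` and `Y = X 1`. -/
abbrev V (F : Type*) [Field F] (m : ℕ) : Type _ := homogeneousSubmodule (Fin 2) F m

/-- The exponent of the monomial `X^a Y^b`. -/
def expo (a b : ℕ) : Fin 2 →₀ ℕ := Finsupp.single 0 a + Finsupp.single 1 b

section basics

variable {F : Type*} [Field F]

theorem expo_degree (a b : ℕ) : (expo a b).degree = a + b := by
  simp [expo, map_add, Finsupp.degree_single]

theorem expo_zero (a b : ℕ) : expo a b 0 = a := by simp [expo]

theorem expo_one (a b : ℕ) : expo a b 1 = b := by simp [expo]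

theorem monomial_expo (a b : ℕ) (c : F) :
    monomial (expo a b) c = C c * X 0 ^ a * X 1 ^ b := by
  rw [expo, X_pow_eq_monomial, X_pow_eq_monomial, C_mul_monomial, monomial_mul]
  simp

/-- The monomial `c X^a Y^b` as an element of `V_m`, where `a + b = m`. -/
def mono {m : ℕ} (a b : ℕ) (h : a + b = m) (c : F) : V F m :=
  ⟨monomial (expo a b) c, isHomogeneous_monomial c ((expo_degree a b).trans h)⟩

/-- The bilinear form `β_m` on `V_m`, namely the bilinear form with
`β_m (X^a Y^b) (X^c Y^d) = (-1)^a / (m choose a)` if `a = d` and `0` otherwise. -/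
def form (F : Type*) [Field F] (m : ℕ) : V F m →ₗ[F] V F m →ₗ[F] F :=
  LinearMap.mk₂ F
    (fun v w => ∑ a ∈ Finset.range (m + 1), (-1) ^ a / (m.choose a : F) *
      (coeff (expo a (m - a)) v.1 * coeff (expo (m - a) a) w.1))
    (fun v v' w => by
      rw [← Finset.sum_add_distrib]
      refine Finset.sum_congr rfl fun a _ => ?_
      simp only [Submodule.coe_add, coeff_add]; ring)
    (fun c v w => by
      rw [smul_eq_mul, Finset.mul_sum]
      refine Finset.sum_congr rfl fun a _ => ?_
      simp only [Submodule.coe_smul, coeff_smul, smul_eq_mul]; ring)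
    (fun v w w' => by
      rw [← Finset.sum_add_distrib]
      refine Finset.sum_congr rfl fun a _ => ?_
      simp only [Submodule.coe_add, coeff_add]; ring)
    (fun c v w => by
      rw [smul_eq_mul, Finset.mul_sum]
      refine Finset.sum_congr rfl fun a _ => ?_
      simp only [Submodule.coe_smul, coeff_smul, smul_eq_mul]; ring)

theorem form_apply {m : ℕ} (v w : V F m) :
    form F m v w = ∑ a ∈ Finset.range (m + 1), (-1) ^ a / (m.choose a : F) *
      (coeff (expo a (m - a)) v.1 * coeff (expo (m - a) a) w.1) := rfl

/-- The defining property of `β_m` on monomials. -/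
theorem form_mono {m a b c d : ℕ} (hab : a + b = m) (hcd : c + d = m) :
    form F m (mono a b hab 1) (mono c d hcd 1) =
      if a = d then (-1) ^ a / (m.choose a : F) else 0 := by
  rw [form_apply, Finset.sum_eq_single a]
  · have h1 : m - a = b := by omega
    by_cases h : a = d
    · have h2 : c = b := by omega
      subst h
      subst h2
      simp [mono, h1, coeff_monomial]
    · have h2 : expo c d ≠ expo b a := fun he => h (by
        have := congrArg (fun f => f 1) he
        simpa [expo_one, eq_comm] using this)
      simp [mono, h1, coeff_monomial, h, h2]
  · intro a' _ hne
    have h2 : expo a b ≠ expo a' (m - a') := fun he => hne (by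
      have := congrArg (fun f => f 0) he
      simpa [expo_zero, eq_comm] using this)
    simp [mono, coeff_monomial, h2]
  · intro h
    exact absurd (Finset.mem_range.2 (by omega)) h

/-- The substitution `X ↦ α X + β Y`, `Y ↦ γ X + δ Y`, for the matrix `A` with rows `(α, β)` and
`(γ, δ)`. -/
def subst (A : Matrix (Fin 2) (Fin 2) F) :
    MvPolynomial (Fin 2) F →ₐ[F] MvPolynomial (Fin 2) F :=
  aeval fun i => C (A i 0) * X 0 + C (A i 1) * X 1

theorem subst_homogeneous {m : ℕ} (A : Matrix (Fin 2) (Fin 2) F) {v : MvPolynomial (Fin 2) F}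
    (hv : v ∈ homogeneousSubmodule (Fin 2) F m) :
    subst A v ∈ homogeneousSubmodule (Fin 2) F m := by
  have h := IsHomogeneous.aeval (n := 1) ((mem_homogeneousSubmodule _ _).1 hv)
    (fun i : Fin 2 => (C (A i 0) * X 0 + C (A i 1) * X 1 : MvPolynomial (Fin 2) F))
    (fun i => (isHomogeneous_C_mul_X _ _).add (isHomogeneous_C_mul_X _ _))
  rw [one_mul] at h
  rw [mem_homogeneousSubmodule]
  exact h

/-- The right action `v · A` of a matrix `A` on `V_m` (without the scalar `t`). -/
def act {m : ℕ} (A : Matrix (Fin 2) (Fin 2) F) : V F m →ₗ[F] V F m :=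
  (subst A).toLinearMap.restrict fun _ hv => subst_homogeneous A hv

theorem act_coe {m : ℕ} (A : Matrix (Fin 2) (Fin 2) F) (v : V F m) :
    (act A v : V F m).1 = subst A v.1 := rfl

theorem act_one {m : ℕ} (v : V F m) : act (1 : Matrix (Fin 2) (Fin 2) F) v = v := by
  apply Subtype.ext
  rw [act_coe]
  have : subst (1 : Matrix (Fin 2) (Fin 2) F) = AlgHom.id F _ := by
    apply MvPolynomial.algHom_ext
    intro i
    fin_cases i <;> simp [subst]
  rw [this]; rfl

theorem act_mul {m : ℕ} (A B : Matrix (Fin 2) (Fin 2) F) (v : V F m) :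
    act (A * B) v = act B (act A v) := by
  apply Subtype.ext
  simp only [act_coe]
  have : subst (A * B) = (subst B).comp (subst A) := by
    apply MvPolynomial.algHom_ext
    intro i
    simp only [subst, aeval_X, AlgHom.comp_apply, map_add, map_mul, algHom_C, Matrix.mul_apply,
      Fin.sum_univ_two, MvPolynomial.algebraMap_eq]
    ring
  rw [this]; rfl

/-- The `m`-th power of the linear form `u X + v Y`. -/
def linPow (m : ℕ) (u v : F) : V F m :=
  ⟨(C u * X 0 + C v * X 1) ^ m, by
    have h := ((isHomogeneous_C_mul_X u (0 : Fin 2)).add (isHomogeneous_C_mul_X v 1)).pow m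
    rw [one_mul] at h
    exact (mem_homogeneousSubmodule _ _).2 h⟩

theorem linPow_eq (m : ℕ) (u v : F) :
    (linPow m u v).1 = ∑ a ∈ Finset.range (m + 1),
      monomial (expo a (m - a)) (u ^ a * v ^ (m - a) * (m.choose a : F)) := by
  change (C u * X 0 + C v * X 1) ^ m = _
  rw [add_pow]
  refine Finset.sum_congr rfl fun a _ => ?_
  rw [monomial_expo]
  simp only [map_mul, map_pow, map_natCast, mul_pow]
  ring

theorem act_linPow (m : ℕ) (A : Matrix (Fin 2) (Fin 2) F) (u v : F) :
    act A (linPow m u v) = linPow m (u * A 0 0 + v * A 1 0) (u * A 0 1 + v * A 1 1) := by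
  apply Subtype.ext
  rw [act_coe]
  simp only [linPow, subst, map_pow, map_add, map_mul, aeval_X, algHom_C,
    MvPolynomial.algebraMap_eq]
  ring

theorem eq_sum {m : ℕ} (w : V F m) :
    w.1 = ∑ a ∈ Finset.range (m + 1), monomial (expo (m - a) a) (coeff (expo (m - a) a) w.1) := by
  ext d
  rw [coeff_sum]
  by_cases hd : d.degree = m
  · have hd2 : d 0 + d 1 = m := by
      rw [Finsupp.degree_eq_sum] at hd
      simpa [Fin.sum_univ_two] using hd
    have he : expo (m - d 1) (d 1) = d := by
      ext i
      fin_cases i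
      · simp only [Fin.zero_eta, expo_zero]; omega
      · simp only [Fin.mk_one, expo_one]
    rw [Finset.sum_eq_single (d 1)]
    · rw [he]; simp
    · intro b _ hb
      rw [coeff_monomial, if_neg]
      intro h
      apply hb
      rw [← h, expo_one]
    · intro h
      exact absurd (Finset.mem_range.2 (by omega)) h
  · rw [((mem_homogeneousSubmodule _ _).1 w.2).coeff_eq_zero hd]
    symm
    refine Finset.sum_eq_zero fun a ha => ?_
    rw [coeff_monomial, if_neg]
    intro h
    apply hd
    rw [← h, expo_degree]
    have := Finset.mem_range.1 ha
    omega

theorem eval_eq {m : ℕ} (w : V F m) (x : Fin 2 → F) :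
    eval x w.1 = ∑ a ∈ Finset.range (m + 1),
      coeff (expo (m - a) a) w.1 * (x 0 ^ (m - a) * x 1 ^ a) := by
  conv_lhs => rw [eq_sum w]
  rw [map_sum]
  refine Finset.sum_congr rfl fun a _ => ?_
  rw [monomial_expo]
  simp [mul_assoc]

theorem choose_ne_zero {p m a : ℕ} [CharP F p] (hm : m < p) (ha : a ≤ m) :
    (m.choose a : F) ≠ 0 := by
  have hp : p.Prime := (CharP.char_is_prime_or_zero F p).resolve_right (by omega)
  rw [Ne, CharP.cast_eq_zero_iff F p]
  intro h
  have h2 : p ∣ m.factorial := by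
    rw [← Nat.choose_mul_factorial_mul_factorial ha, mul_assoc]
    exact h.mul_right _
  have := (hp.dvd_factorial).1 h2
  omega

theorem form_linPow {p m : ℕ} [CharP F p] (hm : m < p) (u v : F) (w : V F m) :
    form F m (linPow m u v) w = eval ![v, -u] w.1 := by
  rw [form_apply, eval_eq]
  refine Finset.sum_congr rfl fun a ha => ?_
  have ha' : a ≤ m := by have := Finset.mem_range.1 ha; omega
  have hc : coeff (expo a (m - a)) (linPow m u v).1 = u ^ a * v ^ (m - a) * (m.choose a : F) := by
    rw [linPow_eq, coeff_sum, Finset.sum_eq_single a]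
    · simp
    · intro b _ hb
      rw [coeff_monomial, if_neg]
      intro h
      apply hb
      have := congrArg (fun f => f 0) h
      simpa [expo_zero] using this
    · intro h; exact absurd ha h
  have h0 := choose_ne_zero (F := F) hm ha'
  rw [hc]
  simp only [Matrix.cons_val_zero, Matrix.cons_val_one, neg_pow u]
  field_simp

theorem linPow_span {p m : ℕ} [CharP F p] (hm : m < p) (h : V F m →ₗ[F] F)
    (h0 : ∀ u : F, h (linPow m u 1) = 0) : h = 0 := by
  have hp : p.Prime := (CharP.char_is_prime_or_zero F p).resolve_right (by omega)
  let mon : ℕ → V F m := fun a =>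
    if ha : a ≤ m then mono a (m - a) (by omega) 1 else 0
  have hmon : ∀ a, ∀ ha : a ≤ m, (mon a).1 = monomial (expo a (m - a)) 1 := by
    intro a ha
    simp only [mon, dif_pos ha]
    rfl
  let q : Polynomial F := ∑ a ∈ Finset.range (m + 1),
    Polynomial.monomial a ((m.choose a : F) * h (mon a))
  have hq : q = 0 := by
    refine Polynomial.eq_zero_of_natDegree_lt_card_of_eval_eq_zero q
      (f := fun i : Fin p => ((i : ℕ) : F)) ?_ ?_ ?_
    · intro i j hij
      exact Fin.ext (CharP.natCast_injOn_Iio F p i.2 j.2 hij)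
    · intro i
      have := h0 ((i : ℕ) : F)
      have hs : linPow m ((i : ℕ) : F) 1 = ∑ a ∈ Finset.range (m + 1),
          ((((i : ℕ) : F) ^ a * (m.choose a : F)) • mon a) := by
        apply Subtype.ext
        rw [linPow_eq, AddSubmonoidClass.coe_finsetSum]
        refine Finset.sum_congr rfl fun a ha => ?_
        have ha' : a ≤ m := by have := Finset.mem_range.1 ha; omega
        rw [Submodule.coe_smul, hmon a ha', smul_monomial]
        simp
      rw [hs, map_sum] at this
      rw [Polynomial.eval_finsetSum, ← this]
      refine Finset.sum_congr rfl fun a _ => ?_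
      rw [Polynomial.eval_monomial, map_smul, smul_eq_mul]
      ring
    · rw [Fintype.card_fin]
      refine lt_of_le_of_lt (Polynomial.natDegree_sum_le_of_forall_le _ _ (n := m) ?_) hm
      intro a ha
      have ha' : a ≤ m := by have := Finset.mem_range.1 ha; omega
      exact (Polynomial.natDegree_monomial_le _).trans ha'
  have hz : ∀ a, a ≤ m → h (mon a) = 0 := by
    intro a ha
    have := congrArg (fun r => Polynomial.coeff r a) hq
    simp only [q, Polynomial.finsetSum_coeff, Polynomial.coeff_monomial, Polynomial.coeff_zero] at this
    rw [Finset.sum_ite_eq' _ a, if_pos (Finset.mem_range.2 (by omega))] at this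
    exact (mul_eq_zero.1 this).resolve_left (choose_ne_zero hm ha)
  ext w
  have hw : w = ∑ a ∈ Finset.range (m + 1), coeff (expo (m - a) a) w.1 • mon (m - a) := by
    apply Subtype.ext
    conv_lhs => rw [eq_sum w]
    rw [AddSubmonoidClass.coe_finsetSum]
    refine Finset.sum_congr rfl fun a ha => ?_
    have ha' : a ≤ m := by have := Finset.mem_range.1 ha; omega
    rw [Submodule.coe_smul, hmon _ (by omega), smul_monomial, Nat.sub_sub_self ha']
    simp
  rw [hw, map_sum, LinearMap.zero_apply]
  refine Finset.sum_eq_zero fun a _ => ?_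
  rw [map_smul, hz _ (by omega), smul_zero]

/-- A matrix `A` scales `β_m` by `(det A)^m`. -/
theorem form_act {p m : ℕ} [CharP F p] (hm : m < p) (A : Matrix (Fin 2) (Fin 2) F)
    (v w : V F m) : form F m (act A v) (act A w) = A.det ^ m * form F m v w := by
  have key : ((form F m).flip (act A w)).comp (act A) - A.det ^ m • (form F m).flip w = 0 := by
    refine linPow_span hm _ fun u => ?_
    simp only [LinearMap.sub_apply, LinearMap.comp_apply, LinearMap.flip_apply,
      LinearMap.smul_apply, smul_eq_mul]
    rw [act_linPow, form_linPow hm, form_linPow hm, act_coe, sub_eq_zero]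
    have h1 : ∀ x : Fin 2 → F, eval x (subst A w.1) =
        eval (fun i => A i 0 * x 0 + A i 1 * x 1) w.1 := by
      intro x
      have : (aeval x : MvPolynomial (Fin 2) F →ₐ[F] F).comp (subst A) =
          aeval (fun i => A i 0 * x 0 + A i 1 * x 1) := by
        apply MvPolynomial.algHom_ext
        intro i
        simp [subst]
      have h2 := congrArg (fun f => f w.1) this
      simpa [MvPolynomial.aeval_eq_eval] using h2
    rw [h1, eval_eq, eval_eq, Finset.mul_sum]
    refine Finset.sum_congr rfl fun a ha => ?_
    have ha' : a ≤ m := by have := Finset.mem_range.1 ha; omega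
    simp only [Matrix.cons_val_zero, Matrix.cons_val_one]
    have e1 : A 0 0 * (u * A 0 1 + 1 * A 1 1) + A 0 1 * -(u * A 0 0 + 1 * A 1 0) = A.det * 1 := by
      rw [Matrix.det_fin_two]; ring
    have e2 : A 1 0 * (u * A 0 1 + 1 * A 1 1) + A 1 1 * -(u * A 0 0 + 1 * A 1 0)
        = A.det * -u := by
      rw [Matrix.det_fin_two]; ring
    rw [e1, e2, mul_pow, mul_pow]
    have e3 : A.det ^ m = A.det ^ (m - a) * A.det ^ a := by
      rw [← pow_add, Nat.sub_add_cancel ha']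
    rw [e3]; ring
  have := congrArg (fun f => f v) key
  simpa [sub_eq_zero] using this

end basics

/-- The set `V_m × F`, underlying the group `Q`. -/
@[ext]
structure Q (F : Type*) [Field F] (m : ℕ) where
  /-- The component in `V_m`. -/
  v : V F m
  /-- The component in `F`. -/
  z : F

variable {F : Type*} [Field F] {p m : ℕ}

/-- `(v, y) (w, z) = (v + w, y + z + β_m (v, w))`. -/
instance : Mul (Q F m) := ⟨fun x y => ⟨x.v + y.v, x.z + y.z + form F m x.v y.v⟩⟩

instance : One (Q F m) := ⟨⟨0, 0⟩⟩

/-- When `β_m` is alternating, this is `(-v, -y)`. -/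
instance : Inv (Q F m) := ⟨fun x => ⟨-x.v, -x.z + form F m x.v x.v⟩⟩

@[simp] theorem Q.mul_v (x y : Q F m) : (x * y).v = x.v + y.v := rfl
@[simp] theorem Q.mul_z (x y : Q F m) : (x * y).z = x.z + y.z + form F m x.v y.v := rfl
@[simp] theorem Q.one_v : (1 : Q F m).v = 0 := rfl
@[simp] theorem Q.one_z : (1 : Q F m).z = 0 := rfl
@[simp] theorem Q.inv_v (x : Q F m) : x⁻¹.v = -x.v := rfl
@[simp] theorem Q.inv_z (x : Q F m) : x⁻¹.z = -x.z + form F m x.v x.v := rfl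

instance : Group (Q F m) :=
  Group.ofLeftAxioms
    (fun x y z => by
      apply Q.ext
      · simp [add_assoc]
      · simp only [Q.mul_v, Q.mul_z, map_add, LinearMap.add_apply]; ring)
    (fun x => by apply Q.ext <;> simp)
    (fun x => by
      apply Q.ext
      · simp
      · simp)

/-- The group `L = F^× × GL_2(F)`. -/
abbrev L (F : Type*) [Field F] : Type _ := Fˣ × GL (Fin 2) F

/-- The right action of `L` on `Q`: `(v, z)^(t, A) = (t (v · A), t^2 (det A)^m z)`. -/
def rightAct (l : L F) (x : Q F m) : Q F m :=
  ⟨(l.1 : F) • act (l.2 : Matrix (Fin 2) (Fin 2) F) x.v,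
    (l.1 : F) ^ 2 * (l.2 : Matrix (Fin 2) (Fin 2) F).det ^ m * x.z⟩

theorem rightAct_one (x : Q F m) : rightAct (1 : L F) x = x := by
  apply Q.ext
  · simp [rightAct, act_one]
  · simp [rightAct]

theorem rightAct_mul_left (k l : L F) (x : Q F m) :
    rightAct (k * l) x = rightAct l (rightAct k x) := by
  apply Q.ext
  · change ((k.1 * l.1 : Fˣ) : F) • act ((k.2 * l.2 : GL (Fin 2) F) : Matrix (Fin 2) (Fin 2) F) x.v =
      (l.1 : F) • act (l.2 : Matrix (Fin 2) (Fin 2) F)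
        ((k.1 : F) • act (k.2 : Matrix (Fin 2) (Fin 2) F) x.v)
    rw [map_smul, smul_smul, Units.val_mul, Units.val_mul, act_mul, mul_comm]
  · simp only [rightAct, Prod.fst_mul, Prod.snd_mul, Units.val_mul, Matrix.det_mul]
    ring

theorem rightAct_mul [CharP F p] (hm : m < p) (l : L F) (x y : Q F m) :
    rightAct l (x * y) = rightAct l x * rightAct l y := by
  apply Q.ext
  · simp [rightAct]
  · simp only [rightAct, Q.mul_z, Q.mul_v, map_smul, LinearMap.smul_apply, smul_eq_mul,
      form_act hm]
    ring

/-- The homomorphism `L → Aut Q` whose value at `l` is the right action of `l⁻¹`; it makes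
`l⁻¹ q l = q ^ l` true in the semidirect product. -/
def toAut [CharP F p] (hm : m < p) : L F →* MulAut (Q F m) where
  toFun l :=
    { toFun := rightAct l⁻¹
      invFun := rightAct l
      left_inv := fun x => by rw [← rightAct_mul_left, inv_mul_cancel, rightAct_one]
      right_inv := fun x => by rw [← rightAct_mul_left, mul_inv_cancel, rightAct_one]
      map_mul' := rightAct_mul hm l⁻¹ }
  map_one' := by
    ext x : 1
    exact (congrArg (fun l => rightAct l x) inv_one).trans (rightAct_one x)
  map_mul' k l := by
    ext x : 1
    exact (congrArg (fun l => rightAct l x) (mul_inv_rev k l)).trans (rightAct_mul_left _ _ x)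

variable (F) in
/-- The group `P = P(m, F) = L Q`, the semidirect product of `Q` and `L`. -/
abbrev P [CharP F p] (hm : m < p) : Type _ := Q F m ⋊[toAut (F := F) hm] L F

/-- In `P`, conjugation by elements of `L` is the right action: `l⁻¹ q l = q ^ l`. -/
theorem conj_eq [CharP F p] (hm : m < p) (l : L F) (x : Q F m) :
    (SemidirectProduct.inr l⁻¹ * SemidirectProduct.inl x * SemidirectProduct.inr l : P F hm) =
      SemidirectProduct.inl (rightAct l x) := by
  rw [← SemidirectProduct.inl_aut_inv]
  rfl

variable (F) in
/-- `C_L(Q)`, as a subgroup of `P`. -/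
def CLQ [CharP F p] (hm : m < p) : Subgroup (P F hm) :=
  (SemidirectProduct.inr : L F →* P F hm).range ⊓
    Subgroup.centralizer ((SemidirectProduct.inl : Q F m →* P F hm).range : Set (P F hm))

instance [CharP F p] (hm : m < p) : (CLQ F hm).Normal where
  conj_mem := by
    rintro n ⟨⟨l, rfl⟩, hc⟩ g
    have hn : (SemidirectProduct.inl : Q F m →* P F hm).range.Normal := by
      rw [SemidirectProduct.range_inl_eq_ker_rightHom]
      infer_instance
    rw [← SemidirectProduct.inl_left_mul_inr_right g]
    set x : P F hm := SemidirectProduct.inl g.left with hx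
    have hxr : x ∈ (SemidirectProduct.inl : Q F m →* P F hm).range := ⟨_, rfl⟩
    set y : P F hm := SemidirectProduct.inr g.right with hy
    have h1 : y * SemidirectProduct.inr l * y⁻¹ ∈ CLQ F hm := by
      refine ⟨⟨g.right * l * g.right⁻¹, by simp [hy]⟩, ?_⟩
      have hcn : (Subgroup.centralizer
        ((SemidirectProduct.inl : Q F m →* P F hm).range : Set (P F hm))).Normal := inferInstance
      exact hcn.conj_mem _ hc y
    have h2 : x * (y * SemidirectProduct.inr l * y⁻¹) * x⁻¹ =
        y * SemidirectProduct.inr l * y⁻¹ := by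
      rw [Subgroup.mem_centralizer_iff.1 h1.2 x hxr, mul_inv_cancel_right]
    have h3 : x * y * SemidirectProduct.inr l * (x * y)⁻¹ =
        x * (y * SemidirectProduct.inr l * y⁻¹) * x⁻¹ := by group
    rw [h3, h2]
    exact h1

/-- For a subgroup `W₀` of `P / C_L(Q)`, the subgroup `W₀ Z(P) / Z(P)` of `P / Z(P)`: the image
in `P / Z(P)` of the preimage of `W₀` in `P`. -/
def modCenter [CharP F p] {hm : m < p} (W₀ : Subgroup (P F hm ⧸ CLQ F hm)) :
    Subgroup (P F hm ⧸ Subgroup.center (P F hm)) :=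
  (W₀.comap (QuotientGroup.mk' (CLQ F hm))).map (QuotientGroup.mk' (Subgroup.center (P F hm)))

variable (F) in
/-- The subgroup `K` of `SL_3(F)`: the matrices of determinant `1` with first row `(1, 0, 0)`. -/
def subK : Subgroup (Matrix.SpecialLinearGroup (Fin 3) F) where
  carrier := {M | M 0 0 = 1 ∧ M 0 1 = 0 ∧ M 0 2 = 0}
  one_mem' := by simp
  mul_mem' := by
    rintro M N ⟨a, b, c⟩ ⟨a', b', c'⟩
    simp [Matrix.mul_apply, Fin.sum_univ_three, a, b, c, a', b', c']
  inv_mem' := by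
    rintro M ⟨a, b, c⟩
    have hd := M.det_coe
    rw [Matrix.det_fin_three, a, b, c] at hd
    refine ⟨?_, ?_, ?_⟩
    · rw [Matrix.SpecialLinearGroup.coe_inv, Matrix.adjugate_fin_three]
      simp
      linear_combination hd
    · rw [Matrix.SpecialLinearGroup.coe_inv, Matrix.adjugate_fin_three]
      simp [b, c]
    · rw [Matrix.SpecialLinearGroup.coe_inv, Matrix.adjugate_fin_three]
      simp [b, c]

/-- The matrix with rows `(1, 0, 0)`, `(α, θ, 0)` and `(δ, ε, θ⁻¹)`. -/
def cMatrix (α δ ε : F) (θ : Fˣ) : Matrix.SpecialLinearGroup (Fin 3) F :=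
  ⟨!![1, 0, 0; α, θ, 0; δ, ε, (θ⁻¹ : Fˣ)], by simp [Matrix.det_fin_three]⟩

variable (F) in
/-- The subgroup `C` of `K`. -/
def subC : Subgroup (Matrix.SpecialLinearGroup (Fin 3) F) where
  carrier := {M | ∃ (α δ ε : F) (θ : Fˣ), M = cMatrix α δ ε θ}
  one_mem' := ⟨0, 0, 0, 1, by
    ext i j; fin_cases i <;> fin_cases j <;> simp [cMatrix]⟩
  mul_mem' := by
    rintro _ _ ⟨α, δ, ε, θ, rfl⟩ ⟨α', δ', ε', θ', rfl⟩
    refine ⟨α + θ * α', δ + ε * α' + (θ⁻¹ : Fˣ) * δ', ε * θ' + (θ⁻¹ : Fˣ) * ε', θ * θ', ?_⟩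
    apply Subtype.ext
    rw [Matrix.SpecialLinearGroup.coe_mul]
    ext i j
    fin_cases i <;> fin_cases j <;>
      simp [cMatrix, Matrix.mul_apply, Fin.sum_univ_three, mul_comm]
  inv_mem' := by
    rintro _ ⟨α, δ, ε, θ, rfl⟩
    refine ⟨-((θ⁻¹ : Fˣ) * α), ε * α - θ * δ, -ε, θ⁻¹, ?_⟩
    rw [inv_eq_iff_mul_eq_one]
    apply Subtype.ext
    rw [Matrix.SpecialLinearGroup.coe_mul]
    have h : (θ : F) ≠ 0 := θ.ne_zero
    ext i j
    fin_cases i <;> fin_cases j <;>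
      simp [cMatrix, Matrix.mul_apply, Fin.sum_univ_three, h]
    · field_simp
      ring
    · ring

/-- `O_p(G)`, the subgroup generated by all normal `p`-subgroups of `G` (for finite `G` the
largest normal `p`-subgroup). -/
def pCore (p : ℕ) (G : Type*) [Group G] : Subgroup G :=
  sSup {N : Subgroup G | N.Normal ∧ IsPGroup p N}

variable (F) in
/-- `W = O_p(K)`, as a subgroup of `SL_3(F)`. -/
def subW (p : ℕ) : Subgroup (Matrix.SpecialLinearGroup (Fin 3) F) :=
  (pCore p (subK F)).map (subK F).subtype

/-- `w(λ) = ∑_{j = 0}^m λ^(j+1) / (j+1) * (m choose j) X^j Y^(m-j)`. -/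
def w (m : ℕ) (lam : F) : V F m :=
  ∑ j : Fin (m + 1), mono (j : ℕ) (m - j) (by omega)
    (lam ^ ((j : ℕ) + 1) / ((j : ℕ) + 1 : F) * (m.choose j : F))

/-- The invertible matrix with rows `(a, 0)` and `(c, b)`. -/
def lower (a b : Fˣ) (c : F) : GL (Fin 2) F :=
  Matrix.GeneralLinearGroup.mkOfDetNeZero !![(a : F), 0; c, (b : F)] (by
    simp [Matrix.det_fin_two_of])

/-- The element
`(a / b^(m+1), (a, 0; b λ, b)) (w(λ) + τ X^m, θ)` of `P = L Q`. -/
def nElt [CharP F p] (hm : m < p) (a b : Fˣ) (lam τ θ : F) : P F hm :=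
  SemidirectProduct.inr (a / b ^ (m + 1), lower a b (b * lam)) *
    SemidirectProduct.inl ⟨w m lam + mono m 0 (by omega) τ, θ⟩

variable (F) in
/-- The subgroup of `P` generated by the elements `(1, (1, 0; γ, 1)) (w(γ), δ)`. -/
def W0 [CharP F p] (hm : m < p) : Subgroup (P F hm) :=
  Subgroup.closure {x | ∃ γ δ : F,
    x = SemidirectProduct.inr (1, lower 1 1 γ) * SemidirectProduct.inl ⟨w m γ, δ⟩}

/-- The value of `Θ` at `(a / b^(m+1), (a, 0; b λ, b)) (w(λ) + τ X^m, θ)`: the matrix with rows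
`(1, 0, 0)`, `((b/a) λ, b/a, 0)` and
`((a/b) (θ + λ^(m+2) / ((m+1)(m+2)) - λ τ), -2 (a/b) τ, a/b)`. -/
def thetaVal (m : ℕ) (a b : Fˣ) (lam τ θ : F) : Matrix.SpecialLinearGroup (Fin 3) F :=
  cMatrix (b / a * lam)
    (a / b * (θ + lam ^ (m + 2) / (((m : F) + 1) * ((m : F) + 2)) - lam * τ))
    (-2 * (a / b) * τ) (b / a)

/-- `N_{P/Z(P)}(W₀ Z(P) / Z(P))`. -/
abbrev normBar [CharP F p] {hm : m < p} (W₀ : Subgroup (P F hm ⧸ CLQ F hm)) :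
    Subgroup (P F hm ⧸ Subgroup.center (P F hm)) :=
  Subgroup.normalizer (modCenter W₀ : Set (P F hm ⧸ Subgroup.center (P F hm)))

/-- The image, as a subgroup of `SL_3(F)`, of `W₀ Z(P) / Z(P)` under an isomorphism `e` from its
normalizer in `P / Z(P)` to `C`. -/
def imageUnder [CharP F p] {hm : m < p} (W₀ : Subgroup (P F hm ⧸ CLQ F hm))
    (e : normBar W₀ ≃* subC F) : Subgroup (Matrix.SpecialLinearGroup (Fin 3) F) :=
  (((modCenter W₀).subgroupOf (normBar W₀)).map e.toMonoidHom).map (subC F).subtype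

variable (F) in
/-- The normalizer in `P` of the explicit subgroup `W0`. -/
abbrev normW0 [CharP F p] (hm : m < p) : Subgroup (P F hm) :=
  Subgroup.normalizer (W0 F hm : Set (P F hm))

variable (F) in
/-- The image of the explicit subgroup `W0` in `P / C_L(Q)`. -/
abbrev W0bar [CharP F p] (hm : m < p) : Subgroup (P F hm ⧸ CLQ F hm) :=
  (W0 F hm).map (QuotientGroup.mk' (CLQ F hm))

end

end BinaryAmalgam

/-!
Modulo the centre `Z(P) = C_L(Q)`, which is the group of the `(a^(-m), a I)` and has no `p`-torsion,
the group `P` has the Sylow `p`-subgroup `U Q`, where `U` consists of the unipotent lower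
triangular matrices.

*The explicit subgroup.* `w(λ)` is the formal integral of `(s X + Y)^m` over `s` from `0` to `λ`, that
is, `(m + 1) X w(λ) = (λ X + Y)^(m+1) - Y^(m+1)` (`X_mul_w`). So `w` is a cocycle on `U` that is
equivariant under suitably scaled diagonal matrices (`smul_act_w`). This gives the multiplication of
the elements of `N_P(W₀)` (`nElt_mul`), up to the values of `β_m` on the `w(λ)`, which follow from the
binomial theorem (`form_w_w`). If `|F| = p = m + 4`, then `r^(m+3) = 1` for all nonzero `r`, and this
turns `Θ` into a homomorphism (`thetaVal_mul`). As the centre has no `p`-torsion, normalizers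
modulo the centre are images of normalizers (`mem_normalizer_map_mk_iff`), and `Θ` descends.

*Necessity.* Let `φ : C → P / Z(P)` be an embedding whose image is the normalizer of `φ(W)`; by
Sylow's theorem `φ(W)` may be assumed to lie in the image of `U Q`. Since `W` is its own centralizer
in `C`, the group `φ(W)` contains the centre `{(0, z)}` of `Q` (`exists_centre_eq`). It is not
contained in `Q` (`exists_unipotent_ne_zero`), as otherwise `(-1, I)` would provide an involution of
`C` with nontrivial fixed points on `W`. The elements `(τ X^m, z)` of `Q` normalize `φ(W)`, and
comparing commutators with them in `C` and in `P` shows that the coefficient of `Y^m` vanishes exactly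
on `φ(Z)`, where `Z` is the subgroup of `W` with first coordinate zero
(`coeffY_eq_zero_iff`). Now the diagonal element of `C` with entries `θ, θ⁻¹`, for a generator `θ` of
`F^×`, acts on `φ(W) / φ(Z)` and on `φ(Z)` by scalars both in terms of `C` and in terms of `P`. The
scalars are compared by additive maps, hence agree up to Frobenius powers
(`exists_frobenius_of_intertwines`), and eliminating the parameters of the element of `P` gives
`λ^(m + 2 p^j + p^k) = 1` for a generator `λ` of `F^×`. For `p ≥ 5` a size estimate leaves only
`|F| = p = m + 4` (`card_eq_of_pow_eq_one`). For `p = 3` and `m = 1` the elements of `U Q` that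
should form `φ(W)` have order `9` (`cube_ne_one`).
-/

namespace BinaryAmalgam

open MvPolynomial

noncomputable section

/-! ### The form and the action on `V_m` -/

section linear

variable {F : Type*} [Field F] {p m : ℕ}

variable (F m) in
/-- The coefficient of `Y^m`, as a linear functional on `V_m`. -/
def coeffY : V F m →ₗ[F] F := (lcoeff F (expo 0 m)).comp (Submodule.subtype _)

variable (m) in
/-- The element `τ X^m` of `V_m`. -/
def monoX (τ : F) : V F m := mono m 0 (by omega) τ

theorem coeffY_apply (v : V F m) : coeffY F m v = coeff (expo 0 m) v.1 := rfl

theorem monoX_add (s t : F) : monoX m (s + t) = monoX m s + monoX m t :=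
  Subtype.ext (map_add (monomial (expo m 0)) s t)

theorem smul_monoX (s t : F) : s • monoX m t = monoX m (s * t) :=
  Subtype.ext (smul_monomial _)

theorem monoX_zero : monoX m (0 : F) = 0 := Subtype.ext (map_zero _)

theorem monoX_eq (τ : F) : (monoX m τ).1 = C τ * X 0 ^ m := by
  change monomial (expo m 0) τ = _
  rw [monomial_expo]; simp

theorem coeff_monoX (τ : F) (a b : ℕ) :
    coeff (expo a b) (monoX m τ).1 = if a = m ∧ b = 0 then τ else 0 := by
  change coeff _ (monomial (expo m 0) τ) = _
  rw [coeff_monomial]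
  refine if_congr ⟨fun h => ?_, fun h => by rw [h.1, h.2]⟩ rfl rfl
  have h0 := congrArg (fun f => f 0) h
  have h1 := congrArg (fun f => f 1) h
  simp only [expo_zero, expo_one] at h0 h1
  exact ⟨h0.symm, h1.symm⟩

theorem monoX_injective : Function.Injective (monoX m : F → V F m) := fun s t h => by
  have := congrArg (fun v : V F m => coeff (expo m 0) v.1) h
  simpa [coeff_monoX] using this

theorem coeffY_monoX (hm0 : m ≠ 0) (τ : F) : coeffY F m (monoX m τ) = 0 := by
  rw [coeffY_apply, coeff_monoX, if_neg (by omega)]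

theorem form_monoX_left (hodd : Odd m) (τ : F) (v : V F m) :
    form F m (monoX m τ) v = -(τ * coeffY F m v) := by
  rw [form_apply, Finset.sum_eq_single m]
  · simp [coeff_monoX, coeffY_apply, hodd.neg_one_pow]
  · intro a _ ha
    rw [coeff_monoX, if_neg (by omega)]; simp
  · intro h; exact absurd (Finset.mem_range.2 (by omega)) h

theorem form_monoX_right (v : V F m) (τ : F) :
    form F m v (monoX m τ) = τ * coeffY F m v := by
  rw [form_apply, Finset.sum_eq_single 0]
  · simp [coeff_monoX, coeffY_apply, mul_comm]
  · intro a _ ha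
    rw [coeff_monoX, if_neg (by omega)]; simp
  · intro h; exact absurd (Finset.mem_range.2 (by omega)) h

theorem coeffY_eq_eval (v : V F m) : coeffY F m v = eval ![0, 1] v.1 := by
  rw [eval_eq, Finset.sum_eq_single m]
  · simp [coeffY_apply]
  · intro a ha hne
    have := Finset.mem_range.1 ha
    simp [zero_pow (show m - a ≠ 0 by omega)]
  · intro h; exact absurd (Finset.mem_range.2 (by omega)) h

theorem eval_subst (A : Matrix (Fin 2) (Fin 2) F) (v : MvPolynomial (Fin 2) F) (x : Fin 2 → F) :
    eval x (subst A v) = eval (fun i => A i 0 * x 0 + A i 1 * x 1) v := by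
  have : (aeval x : MvPolynomial (Fin 2) F →ₐ[F] F).comp (subst A) =
      aeval (fun i => A i 0 * x 0 + A i 1 * x 1) := by
    apply MvPolynomial.algHom_ext
    intro i
    simp [subst]
  have h2 := congrArg (fun f => f v) this
  simpa [MvPolynomial.aeval_eq_eval] using h2

@[simp] theorem lower_zero_zero (a b : Fˣ) (c : F) : (lower a b c).1 0 0 = a := rfl
@[simp] theorem lower_zero_one (a b : Fˣ) (c : F) : (lower a b c).1 0 1 = 0 := rfl
@[simp] theorem lower_one_zero (a b : Fˣ) (c : F) : (lower a b c).1 1 0 = c := rfl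
@[simp] theorem lower_one_one (a b : Fˣ) (c : F) : (lower a b c).1 1 1 = b := rfl

@[simp] theorem det_lower (a b : Fˣ) (c : F) : (lower a b c).1.det = a * b := by
  rw [Matrix.det_fin_two]; simp

theorem lower_mul (a b a' b' : Fˣ) (c c' : F) :
    lower a b c * lower a' b' c' = lower (a * a') (b * b') (c * a' + b * c') := by
  apply Units.ext
  ext i j
  fin_cases i <;> fin_cases j <;> simp [lower, Matrix.mul_apply, Fin.sum_univ_two]

theorem lower_one : lower (1 : Fˣ) 1 0 = 1 := by
  apply Units.ext
  ext i j
  fin_cases i <;> fin_cases j <;> simp [lower]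

theorem lower_injective {a b a' b' : Fˣ} {c c' : F} (h : lower a b c = lower a' b' c') :
    a = a' ∧ b = b' ∧ c = c' := by
  have e (i j : Fin 2) : (lower a b c).1 i j = (lower a' b' c').1 i j := by rw [h]
  exact ⟨Units.ext (e 0 0), Units.ext (e 1 1), e 1 0⟩

theorem eq_lower (A : GL (Fin 2) F) (h : A.1 0 1 = 0) :
    ∃ (a b : Fˣ) (c : F), A = lower a b c := by
  have hd : A.1.det ≠ 0 := ((Matrix.isUnit_iff_isUnit_det _).1 A.isUnit).ne_zero
  rw [Matrix.det_fin_two, h, zero_mul, sub_zero] at hd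
  refine ⟨Units.mk0 _ (left_ne_zero_of_mul hd), Units.mk0 _ (right_ne_zero_of_mul hd), A.1 1 0, ?_⟩
  apply Units.ext
  ext i j
  fin_cases i <;> fin_cases j <;> simp [h]

theorem coeffY_act_lower (a b : Fˣ) (c : F) (v : V F m) :
    coeffY F m (act (lower a b c).1 v) = (b : F) ^ m * coeffY F m v := by
  rw [coeffY_eq_eval, act_coe, eval_subst, eval_eq, coeffY_apply, Finset.sum_eq_single m]
  · simp [mul_comm]
  · intro j hj hne
    have := Finset.mem_range.1 hj
    simp [zero_pow (show m - j ≠ 0 by omega)]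
  · intro h; exact absurd (Finset.mem_range.2 (by omega)) h

theorem act_lower_monoX (a b : Fˣ) (c τ : F) :
    act (lower a b c).1 (monoX m τ) = monoX m ((a : F) ^ m * τ) := by
  apply Subtype.ext
  rw [act_coe, monoX_eq, monoX_eq]
  simp only [subst, map_mul, map_pow, aeval_X, algHom_C, lower_zero_zero, lower_zero_one,
    MvPolynomial.algebraMap_eq, map_zero, zero_mul, add_zero]
  ring

/-- A nontrivial unipotent lower triangular matrix fixes only the multiples of `X^m`: for fixed
`v`, the polynomial `v(1, s)` of degree at most `m < p` is constant on `F_p γ`, hence constant. -/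
theorem eq_monoX_of_fixed [CharP F p] (hm : m < p) {γ : F} (hγ : γ ≠ 0) {v : V F m}
    (hv : act (lower 1 1 γ).1 v = v) : ∃ τ, v = monoX m τ := by
  have hp : p.Prime := (CharP.char_is_prime_or_zero F p).resolve_right (by omega)
  let f : Polynomial F := ∑ a ∈ Finset.range (m + 1),
    Polynomial.monomial a (coeff (expo (m - a) a) v.1)
  have hf : ∀ s, f.eval s = eval ![1, s] v.1 := by
    intro s
    rw [eval_eq, Polynomial.eval_finsetSum]
    refine Finset.sum_congr rfl fun a _ => ?_
    simp
  have hstep : ∀ s, f.eval (s + γ) = f.eval s := by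
    intro s
    rw [hf, hf]
    conv_rhs => rw [← hv, act_coe, eval_subst]
    congr 1
    congr 1
    ext i
    fin_cases i <;> simp [add_comm]
  have hk : ∀ k : ℕ, f.eval (k * γ) = f.eval 0 := by
    intro k
    induction k with
    | zero => simp
    | succ k ih => rw [Nat.cast_succ, add_mul, one_mul, hstep, ih]
  have hq : f - Polynomial.C (f.eval 0) = 0 := by
    refine Polynomial.eq_zero_of_natDegree_lt_card_of_eval_eq_zero _
      (f := fun i : Fin p => ((i : ℕ) : F) * γ) ?_ ?_ ?_
    · intro i j hij
      exact Fin.ext (CharP.natCast_injOn_Iio F p i.2 j.2 (mul_right_cancel₀ hγ hij))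
    · intro i
      rw [Polynomial.eval_sub, Polynomial.eval_C, hk, sub_self]
    · rw [Fintype.card_fin, Polynomial.natDegree_sub_C]
      refine lt_of_le_of_lt (Polynomial.natDegree_sum_le_of_forall_le _ _ (n := m) ?_) hm
      intro a ha
      have := Finset.mem_range.1 ha
      exact (Polynomial.natDegree_monomial_le _).trans (by omega)
  have hc : ∀ a, a ≤ m → a ≠ 0 → coeff (expo (m - a) a) v.1 = 0 := by
    intro a ha ha0
    have := congrArg (fun r => Polynomial.coeff r a) hq
    simp only [f, Polynomial.coeff_sub, Polynomial.finsetSum_coeff, Polynomial.coeff_monomial,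
      Polynomial.coeff_zero, Polynomial.coeff_C_of_ne_zero ha0] at this
    rwa [Finset.sum_ite_eq' _ a, if_pos (Finset.mem_range.2 (by omega)), sub_zero] at this
  refine ⟨coeff (expo m 0) v.1, Subtype.ext ((eq_sum v).trans ?_)⟩
  rw [Finset.sum_eq_single 0]
  · rfl
  · intro a ha ha0
    rw [hc a (by have := Finset.mem_range.1 ha; omega) ha0, map_zero]
  · intro h; exact absurd (Finset.mem_range.2 (by omega)) h

theorem act_monoX_of_unipotent (γ τ : F) :
    act (lower 1 1 γ).1 (monoX m τ) = monoX m τ := by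
  rw [act_lower_monoX]; simp

end linear

/-! ### Calculus in the semidirect product -/

section calculus

variable {F : Type*} [Field F] {p m : ℕ} [CharP F p] {hm : m < p}

@[simp] theorem rightAct_v (l : L F) (x : Q F m) :
    (rightAct l x).v = (l.1 : F) • act (l.2 : Matrix (Fin 2) (Fin 2) F) x.v := rfl

@[simp] theorem rightAct_z (l : L F) (x : Q F m) :
    (rightAct l x).z = (l.1 : F) ^ 2 * (l.2 : Matrix (Fin 2) (Fin 2) F).det ^ m * x.z := rfl

variable (hm) in
/-- The element `l x` of `P = L Q`, for `l ∈ L` and `x ∈ Q`. -/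
def elt (l : L F) (x : Q F m) : P F hm :=
  SemidirectProduct.inr l * SemidirectProduct.inl x

theorem elt_mul (l k : L F) (x y : Q F m) :
    elt hm l x * elt hm k y = elt hm (l * k) (rightAct k x * y) := by
  have h := conj_eq hm k x
  rw [map_inv, mul_assoc, inv_mul_eq_iff_eq_mul] at h
  simp only [elt, map_mul]
  rw [mul_assoc, ← mul_assoc (SemidirectProduct.inl x), h]
  simp only [mul_assoc]

theorem elt_one : elt hm (1 : L F) (1 : Q F m) = 1 := by simp [elt]

@[simp] theorem elt_right (l : L F) (x : Q F m) : (elt hm l x).right = l := by simp [elt]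

theorem elt_injective {l k : L F} {x y : Q F m} (h : elt hm l x = elt hm k y) :
    l = k ∧ x = y := by
  have h1 : l = k := by
    have := congrArg SemidirectProduct.right h
    simpa using this
  subst h1
  exact ⟨rfl, SemidirectProduct.inl_injective (mul_left_cancel h)⟩

theorem eq_elt (g : P F hm) : ∃ x, g = elt hm g.right x :=
  ⟨rightAct g.right g.left, by
    have h := conj_eq hm g.right g.left
    rw [elt, ← h, map_inv]
    simp only [← mul_assoc, mul_inv_cancel, one_mul]
    exact (SemidirectProduct.inl_left_mul_inr_right g).symm⟩

theorem inl_eq_elt (x : Q F m) : (SemidirectProduct.inl x : P F hm) = elt hm 1 x := by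
  simp [elt]

theorem inr_eq_elt (l : L F) : (SemidirectProduct.inr l : P F hm) = elt hm l 1 := by
  simp [elt]

theorem unip_mul (γ δ : F) :
    ((1, lower 1 1 γ) * (1, lower 1 1 δ) : L F) = (1, lower 1 1 (γ + δ)) := by
  rw [Prod.mk_mul_mk, lower_mul]; simp

theorem unip_zero : ((1, lower 1 1 0) : L F) = 1 := by rw [lower_one]; rfl

theorem Q.pow_v (x : Q F m) (n : ℕ) : (x ^ n).v = n • x.v := by
  induction n with
  | zero => simp
  | succ n ih => rw [pow_succ, Q.mul_v, ih, succ_nsmul]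

theorem Q.pow_z {x : Q F m} (hx : x.v = 0) (n : ℕ) : (x ^ n).z = n * x.z := by
  induction n with
  | zero => simp
  | succ n ih => rw [pow_succ, Q.mul_z, hx, map_zero, ih]; push_cast; ring

theorem Q.pow_p_pow_p (x : Q F m) : (x ^ p) ^ p = 1 := by
  have h : (x ^ p).v = 0 := by
    rw [Q.pow_v, ← Nat.cast_smul_eq_nsmul F, CharP.cast_eq_zero, zero_smul]
  apply Q.ext
  · rw [Q.pow_v, h, smul_zero]; rfl
  · rw [Q.pow_z h, CharP.cast_eq_zero, zero_mul]; rfl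

variable (F) in
/-- The homomorphism `γ ↦ (1, (1, 0; γ, 1))` from the additive group of `F` to `L`. -/
def unipHom : Multiplicative F →* L F where
  toFun γ := (1, lower 1 1 γ.toAdd)
  map_one' := unip_zero
  map_mul' γ δ := (unip_mul γ.toAdd δ.toAdd).symm

theorem unipHom_apply (γ : Multiplicative F) : unipHom F γ = (1, lower 1 1 γ.toAdd) := rfl

theorem unipHom_injective : Function.Injective (unipHom F) := fun _ _ h =>
  (lower_injective (congrArg Prod.snd h)).2.2

variable (F hm) in
/-- The preimage in `P` of the unipotent lower triangular matrices; a Sylow `p`-subgroup of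
`P`. -/
def sylowP : Subgroup (P F hm) := (unipHom F).range.comap SemidirectProduct.rightHom

theorem mem_sylowP {g : P F hm} :
    g ∈ sylowP F hm ↔ ∃ γ x, g = elt hm (1, lower 1 1 γ) x := by
  constructor
  · rintro ⟨γ, hγ⟩
    obtain ⟨x, hx⟩ := eq_elt g
    refine ⟨γ.toAdd, x, hx.trans ?_⟩
    rw [← unipHom_apply, hγ]; rfl
  · rintro ⟨γ, x, rfl⟩
    exact ⟨Multiplicative.ofAdd γ, by simp [unipHom_apply]⟩

/-- The `p`-th power of `g` lies in `Q`, and the `p`-th power of that in the centre of `Q`. -/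
theorem pow_eq_one_of_mem_sylowP {g : P F hm} (hg : g ∈ sylowP F hm) : g ^ p ^ 3 = 1 := by
  obtain ⟨γ, hγ⟩ := hg
  have h1 : (g ^ p).right = 1 := by
    have : SemidirectProduct.rightHom (g ^ p) = 1 := by
      rw [map_pow, ← hγ, ← map_pow]
      have : γ ^ p = 1 := by
        apply Multiplicative.toAdd.injective
        rw [toAdd_pow, ← Nat.cast_smul_eq_nsmul F, CharP.cast_eq_zero, zero_smul]; rfl
      rw [this, map_one]
    exact this
  obtain ⟨x, hx⟩ := eq_elt (g ^ p)
  rw [h1, ← inl_eq_elt] at hx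
  rw [show p ^ 3 = p * p * p by ring, pow_mul, pow_mul, hx, ← map_pow, ← map_pow, Q.pow_p_pow_p,
    map_one]

end calculus

/-! ### The centre of `P` -/

section centre

variable {F : Type*} [Field F] {p m : ℕ} [CharP F p] {hm : m < p}

theorem eval_linPow (u v : F) (x : Fin 2 → F) :
    eval x (linPow m u v).1 = (u * x 0 + v * x 1) ^ m := by
  change eval x ((C u * X 0 + C v * X 1) ^ m) = _
  simp

/-- An element `(t, A)` of `L` that centralizes `Q` is of the form `(a^(-m), a I)`; the scalar is
written in the form in which it occurs in `nElt`. -/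
theorem eq_scalar_of_mem_CLQ (hm0 : m ≠ 0) {g : P F hm} (hg : g ∈ CLQ F hm) :
    ∃ a : Fˣ, g = SemidirectProduct.inr (a / a ^ (m + 1), lower a a 0) := by
  obtain ⟨⟨l, rfl⟩, hc⟩ := hg
  replace hc := Subgroup.mem_centralizer_iff.1 hc
  have key : ∀ v : V F m, (l.1 : F) • act l.2.1 v = v := by
    intro v
    have h := hc (SemidirectProduct.inl ⟨v, 0⟩) ⟨_, rfl⟩
    rw [inl_eq_elt, inr_eq_elt, elt_mul, elt_mul] at h
    have h2 := congrArg Q.v (elt_injective h).2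
    simpa [rightAct_one] using h2
  have hev : ∀ u v x y : F, (l.1 : F) * ((u * l.2.1 0 0 + v * l.2.1 1 0) * x +
      (u * l.2.1 0 1 + v * l.2.1 1 1) * y) ^ m = (u * x + v * y) ^ m := by
    intro u v x y
    have h := congrArg (fun w : V F m => eval ![x, y] w.1) (key (linPow m u v))
    rw [act_linPow] at h
    simpa only [Submodule.coe_smul, smul_eval, eval_linPow, Matrix.cons_val_zero,
      Matrix.cons_val_one] using h
  have ht : (l.1 : F) ≠ 0 := l.1.ne_zero
  have h01 : l.2.1 0 1 = 0 := by
    have := hev 1 0 0 1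
    simpa [hm0, ht] using this
  have h10 : l.2.1 1 0 = 0 := by
    have := hev 0 1 1 0
    simpa [hm0, ht] using this
  have h11 : l.2.1 0 0 = l.2.1 1 1 := by
    have := hev 1 1 1 (-1)
    simp only [h01, h10] at this
    simp only [one_mul, add_zero, zero_add, mul_one, mul_neg, add_neg_cancel, zero_pow hm0,
      mul_eq_zero, ht, false_or, pow_eq_zero_iff hm0] at this
    linear_combination this
  have h00 : (l.1 : F) * l.2.1 0 0 ^ m = 1 := by
    have := hev 1 0 1 0
    simpa using this
  obtain ⟨a, b, c, hA⟩ := eq_lower l.2 h01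
  obtain ⟨t, A⟩ := l
  simp only at hA h00 h10 h11
  subst hA
  simp only [lower_zero_zero, lower_one_zero, lower_one_one] at h00 h10 h11
  have hab : a = b := Units.ext h11
  subst hab h10
  refine ⟨a, congrArg _ (Prod.ext ?_ rfl)⟩
  have : t * a ^ m = 1 := Units.ext (by simpa using h00)
  change t = a / a ^ (m + 1)
  rw [eq_div_iff_mul_eq', pow_succ, ← mul_assoc, this, one_mul]

theorem act_scalar (b : Fˣ) (v : V F m) : act (lower b b 0).1 v = (b : F) ^ m • v := by
  have key : ∀ c : ℕ → F,
      subst (lower b b 0).1 (∑ a ∈ Finset.range (m + 1), monomial (expo (m - a) a) (c a)) =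
        C ((b : F) ^ m) * ∑ a ∈ Finset.range (m + 1), monomial (expo (m - a) a) (c a) := by
    intro c
    rw [map_sum, Finset.mul_sum]
    refine Finset.sum_congr rfl fun a ha => ?_
    have ha' := Finset.mem_range.1 ha
    have h0 : subst (lower b b 0).1 (X 0) = C (b : F) * X 0 := by simp [subst]
    have h1 : subst (lower b b 0).1 (X 1) = C (b : F) * X 1 := by simp [subst]
    have hb : (b : F) ^ m = (b : F) ^ (m - a) * (b : F) ^ a := by
      rw [← pow_add]; congr 1; omega
    rw [monomial_expo, map_mul, map_mul, map_pow, map_pow, h0, h1, algHom_C,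
      MvPolynomial.algebraMap_eq, hb, map_mul, map_pow, map_pow]
    ring
  apply Subtype.ext
  have h := key fun a => coeff (expo (m - a) a) v.1
  rw [← eq_sum v] at h
  rw [act_coe, h, Submodule.coe_smul, smul_eq_C_mul]

theorem rightAct_scalar (b : Fˣ) (x : Q F m) :
    rightAct (b / b ^ (m + 1), lower b b 0) x = x := by
  apply Q.ext
  · rw [rightAct_v, act_scalar, smul_smul, Units.val_div_eq_div_val, Units.val_pow_eq_pow_val]
    have : (b : F) / b ^ (m + 1) * b ^ m = 1 := by field_simp; ring
    rw [this, one_smul]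
  · rw [rightAct_z, det_lower, Units.val_div_eq_div_val, Units.val_pow_eq_pow_val]
    have : ((b : F) / b ^ (m + 1)) ^ 2 * (b * b) ^ m = 1 := by field_simp; ring
    rw [this, one_mul]

theorem scalar_mem_CLQ (b : Fˣ) :
    (SemidirectProduct.inr (b / b ^ (m + 1), lower b b 0) : P F hm) ∈ CLQ F hm := by
  refine ⟨⟨_, rfl⟩, Subgroup.mem_centralizer_iff.2 ?_⟩
  rintro _ ⟨y, rfl⟩
  have h := conj_eq hm (b / b ^ (m + 1), lower b b 0) y
  rw [rightAct_scalar, map_inv, mul_assoc, inv_mul_eq_iff_eq_mul] at h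
  exact h

theorem scalar_comm (a : Fˣ) (A : GL (Fin 2) F) : lower a a 0 * A = A * lower a a 0 := by
  apply Units.ext
  ext i j
  fin_cases i <;> fin_cases j <;> simp [lower, Matrix.mul_apply, Fin.sum_univ_two, mul_comm]

theorem CLQ_le_center (hm0 : m ≠ 0) : CLQ F hm ≤ Subgroup.center (P F hm) := by
  intro g hg
  obtain ⟨a, ha⟩ := eq_scalar_of_mem_CLQ hm0 hg
  rw [Subgroup.mem_center_iff]
  intro h
  obtain ⟨x, hx⟩ := eq_elt h
  have h1 := Subgroup.mem_centralizer_iff.1 hg.2 (SemidirectProduct.inl x) ⟨x, rfl⟩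
  rw [hx, elt, mul_assoc, h1, ← mul_assoc, ← mul_assoc, ha, ← map_mul, ← map_mul]
  congr 2
  exact Prod.ext (mul_comm _ _) (scalar_comm a _).symm

theorem two_ne_zero_of_char (hp2 : p ≠ 2) : (2 : F) ≠ 0 := by
  have := (Ring.two_ne_zero (R := F)) ((ringChar.eq F p).symm ▸ hp2)
  exact this

theorem center_le_CLQ (hp2 : p ≠ 2) (hodd : Odd m) : Subgroup.center (P F hm) ≤ CLQ F hm := by
  have h2 : (2 : F) ≠ 0 := two_ne_zero_of_char hp2
  intro g hg
  rw [Subgroup.mem_center_iff] at hg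
  obtain ⟨x, hx⟩ := eq_elt g
  have hfix : ∀ k : L F, rightAct k x = x := by
    intro k
    have h := hg (elt hm k 1)
    rw [hx, elt_mul, elt_mul] at h
    have h := (elt_injective h).2
    have h1 : rightAct g.right (1 : Q F m) = 1 := by apply Q.ext <;> simp
    rw [h1, one_mul, mul_one] at h
    exact h.symm
  have hv : x.v = 0 := by
    have h : (-1 : F) • x.v = x.v := by
      have h := congrArg Q.v (hfix (-1, 1))
      rwa [rightAct_v, Units.val_one, act_one, Units.val_neg, Units.val_one] at h
    have h3 : (2 : F) • x.v = 0 := by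
      rw [two_smul]; nth_rewrite 1 [← h]; module
    exact (smul_eq_zero.1 h3).resolve_left h2
  have hz : x.z = 0 := by
    have h := congrArg Q.z (hfix (1, lower (-1) 1 0))
    simp only [rightAct_z, det_lower, Units.val_one, Units.val_neg, mul_one, one_pow,
      hodd.neg_one_pow] at h
    have h3 : (2 : F) * x.z = 0 := by linear_combination -h
    exact (mul_eq_zero.1 h3).resolve_left h2
  have hx1 : x = 1 := Q.ext hv hz
  rw [hx1, ← inr_eq_elt] at hx
  exact ⟨⟨g.right, hx.symm⟩, Subgroup.mem_centralizer_iff.2 fun h _ => hg h⟩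

theorem center_eq_CLQ (hp2 : p ≠ 2) (hodd : Odd m) : Subgroup.center (P F hm) = CLQ F hm :=
  le_antisymm (center_le_CLQ hp2 hodd) (CLQ_le_center hodd.pos.ne')

theorem eq_one_of_pow_p_pow_eq_one (hm : m < p) {x : F} {k : ℕ} (h : x ^ p ^ k = 1) : x = 1 := by
  have hp : p.Prime := (CharP.char_is_prime_or_zero F p).resolve_right (by omega)
  have : ExpChar F p := ExpChar.prime hp
  exact iterateFrobenius_inj F p k (by simpa [iterateFrobenius_def] using h)

/-- The centre `{(a^(-m), a I)} ≅ F^×` of `P` has no `p`-torsion. -/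
theorem eq_one_of_mem_center (hp2 : p ≠ 2) (hodd : Odd m) {g : P F hm}
    (hg : g ∈ Subgroup.center (P F hm)) {k : ℕ} (hk : g ^ p ^ k = 1) : g = 1 := by
  obtain ⟨a, rfl⟩ := eq_scalar_of_mem_CLQ hodd.pos.ne' (center_le_CLQ hp2 hodd hg)
  rw [← map_pow] at hk
  have h1 : (lower a a 0 : GL (Fin 2) F) ^ p ^ k = 1 :=
    congrArg Prod.snd (SemidirectProduct.inr_injective (hk.trans (map_one _).symm))
  have h2 : ∀ n : ℕ, (lower a a 0 : GL (Fin 2) F) ^ n = lower (a ^ n) (a ^ n) 0 := by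
    intro n
    induction n with
    | zero => simp [lower_one]
    | succ n ih => rw [pow_succ, ih, lower_mul]; simp [pow_succ]
  rw [h2, ← lower_one] at h1
  have h3 : a = 1 := Units.ext
    (eq_one_of_pow_p_pow_eq_one hm (by simpa using congrArg Units.val (lower_injective h1).1))
  subst h3
  rw [lower_one, one_pow, div_one]
  exact map_one _

end centre

/-! ### Central quotients without `p`-torsion in the kernel -/

section quotient

variable {G : Type*} [Group G] {p : ℕ}

theorem eq_of_mk_eq (hZ : ∀ z ∈ Subgroup.center G, ∀ k : ℕ, z ^ p ^ k = 1 → z = 1) {x y : G}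
    {k : ℕ} (hx : x ^ p ^ k = 1) (hy : y ^ p ^ k = 1)
    (h : QuotientGroup.mk' (Subgroup.center G) x = QuotientGroup.mk' (Subgroup.center G) y) :
    x = y := by
  obtain ⟨z, hz, rfl⟩ := (QuotientGroup.mk'_eq_mk' _).1 h
  have hc : Commute x z := (Subgroup.mem_center_iff.1 hz) x
  rw [hc.mul_pow, hx, one_mul] at hy
  rw [hZ z hz k hy, mul_one]

/-- If the centre has no `p`-torsion, the normalizer of the image modulo the centre of a
`p`-subgroup is the image of its normalizer. -/
theorem mem_normalizer_map_mk_iff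
    (hZ : ∀ z ∈ Subgroup.center G, ∀ k : ℕ, z ^ p ^ k = 1 → z = 1) {W : Subgroup G} {k : ℕ}
    (hW : ∀ x ∈ W, x ^ p ^ k = 1) (g : G) :
    QuotientGroup.mk' (Subgroup.center G) g ∈ Subgroup.normalizer
        (W.map (QuotientGroup.mk' (Subgroup.center G)) : Set (G ⧸ Subgroup.center G)) ↔
      g ∈ Subgroup.normalizer (W : Set G) := by
  rw [Subgroup.mem_normalizer_iff, Subgroup.mem_normalizer_iff]
  have key : ∀ x, x ^ p ^ k = 1 → (QuotientGroup.mk' (Subgroup.center G) x ∈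
      W.map (QuotientGroup.mk' (Subgroup.center G)) ↔ x ∈ W) := by
    intro x hx
    refine ⟨?_, fun h => Subgroup.mem_map_of_mem _ h⟩
    rintro ⟨y, hy, hxy⟩
    rwa [← eq_of_mk_eq hZ (hW y hy) hx hxy]
  have hpow : ∀ x, (g * x * g⁻¹) ^ p ^ k = 1 ↔ x ^ p ^ k = 1 := by
    intro x
    rw [conj_pow, mul_inv_eq_one, mul_eq_left]
  constructor
  · intro h x
    constructor
    · intro hx
      have := (h (QuotientGroup.mk' _ x)).1 (Subgroup.mem_map_of_mem _ hx)
      rw [← map_inv, ← map_mul, ← map_mul] at this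
      exact (key _ ((hpow x).2 (hW x hx))).1 this
    · intro hx
      have h1 := Subgroup.mem_map_of_mem (QuotientGroup.mk' (Subgroup.center G)) hx
      rw [map_mul, map_mul, map_inv] at h1
      exact (key _ ((hpow x).1 (hW _ hx))).1 ((h _).2 h1)
  · intro h x
    constructor
    · rintro ⟨y, hy, rfl⟩
      rw [← map_inv, ← map_mul, ← map_mul]
      exact Subgroup.mem_map_of_mem _ ((h y).1 hy)
    · rintro ⟨y, hy, hxy⟩
      refine ⟨g⁻¹ * y * g, (h _).2 (by simpa [mul_assoc] using hy), ?_⟩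
      rw [map_mul, map_mul, hxy, map_inv]
      group

end quotient

/-! ### The groups `C` and `W` -/

section target

variable {F : Type*} [Field F] {p : ℕ}

theorem cMatrix_mul (α δ ε α' δ' ε' : F) (θ θ' : Fˣ) :
    cMatrix α δ ε θ * cMatrix α' δ' ε' θ' =
      cMatrix (α + θ * α') (δ + ε * α' + (θ⁻¹ : Fˣ) * δ') (ε * θ' + (θ⁻¹ : Fˣ) * ε')
        (θ * θ') := by
  apply Subtype.ext
  rw [Matrix.SpecialLinearGroup.coe_mul]
  ext i j
  fin_cases i <;> fin_cases j <;>
    simp [cMatrix, Matrix.mul_apply, Fin.sum_univ_three, mul_comm]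

theorem cMatrix_injective {α δ ε α' δ' ε' : F} {θ θ' : Fˣ}
    (h : cMatrix α δ ε θ = cMatrix α' δ' ε' θ') : α = α' ∧ δ = δ' ∧ ε = ε' ∧ θ = θ' := by
  have e (i j : Fin 3) : (cMatrix α δ ε θ).1 i j = (cMatrix α' δ' ε' θ').1 i j := by rw [h]
  exact ⟨e 1 0, e 2 0, e 2 1, Units.ext (e 1 1)⟩

theorem cMatrix_one : cMatrix (0 : F) 0 0 1 = 1 := by
  apply Subtype.ext
  ext i j
  fin_cases i <;> fin_cases j <;> simp [cMatrix]

theorem cMatrix_pow_unip (α δ : F) (n : ℕ) :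
    cMatrix α δ 0 1 ^ n = cMatrix (n * α) (n * δ) 0 1 := by
  induction n with
  | zero => simp [cMatrix_one]
  | succ n ih =>
    rw [pow_succ, ih, cMatrix_mul]
    simp [add_mul]

/-- In characteristic `p`, an element of `p`-power order of `SL_n` is unipotent, so its trace
is `n`. -/
theorem trace_eq_of_pow_eq_one [CharP F p] [Fact p.Prime] {n : ℕ}
    {g : Matrix.SpecialLinearGroup (Fin n) F} {k : ℕ} (h : g ^ p ^ k = 1) :
    g.1.trace = n := by
  rcases Nat.eq_zero_or_pos n with rfl | hn
  · simp
  have : Nonempty (Fin n) := ⟨⟨0, hn⟩⟩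
  have h1 : g.1 ^ p ^ k = 1 := by
    rw [← Matrix.SpecialLinearGroup.coe_pow, h, Matrix.SpecialLinearGroup.coe_one]
  have h2 : (g.1 - 1) ^ p ^ k = 0 := by
    rw [sub_pow_char_pow_of_commute p _ (Commute.one_right _), h1, one_pow, sub_self]
  have h3 := Matrix.isNilpotent_trace_of_isNilpotent ⟨_, h2⟩
  have h4 := h3.eq_zero
  rw [Matrix.trace_sub, Matrix.trace_one, Fintype.card_fin, sub_eq_zero] at h4
  exact h4

/-- The elementary matrix `(1, 0, 0; 0, 1, s; 0, 0, 1)`. -/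
def upperTransvection (s : F) : Matrix.SpecialLinearGroup (Fin 3) F :=
  ⟨!![1, 0, 0; 0, 1, s; 0, 0, 1], by simp [Matrix.det_fin_three]⟩

theorem upperTransvection_mul (s t : F) :
    upperTransvection s * upperTransvection t = upperTransvection (s + t) := by
  apply Subtype.ext
  rw [Matrix.SpecialLinearGroup.coe_mul]
  ext i j
  fin_cases i <;> fin_cases j <;>
    simp [upperTransvection, Matrix.mul_apply, Fin.sum_univ_three, add_comm]

theorem upperTransvection_zero : upperTransvection (0 : F) = 1 := by
  apply Subtype.ext
  ext i j
  fin_cases i <;> fin_cases j <;> simp [upperTransvection]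

/-- Write the lower right block of `g` as `1 + n`. If `g` has trace `3`, then `n` is a traceless
matrix `(x, y; z, -x)` with `x² + y z = 0`, and the product of `g` with its conjugate by an
elementary matrix has trace `3 - y²` or `3 - z²`. So three traces force `n = 0`. -/
theorem eq_translation_of_trace {g : Matrix.SpecialLinearGroup (Fin 3) F} (hg : g ∈ subK F)
    (ht : g.1.trace = 3)
    (hlow : (g.1 * ((cMatrix 0 0 1 1).1 * g.1 * (cMatrix 0 0 (-1) 1).1)).trace = 3)
    (hup : (g.1 * ((upperTransvection 1).1 * g.1 * (upperTransvection (-1)).1)).trace = 3) :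
    ∃ α δ : F, g = cMatrix α δ 0 1 := by
  obtain ⟨h00, h01, h02⟩ := hg
  have hd := g.det_coe
  rw [Matrix.det_fin_three, h00, h01, h02] at hd
  rw [Matrix.trace_fin_three, h00] at ht
  simp only [cMatrix, upperTransvection, Matrix.trace_fin_three, Matrix.mul_apply,
    Fin.sum_univ_three, h00, h01, h02] at hlow hup
  simp at hlow hup
  have hx' : g.1 2 2 = 2 - g.1 1 1 := by linear_combination ht
  rw [hx'] at hd hlow hup
  have hy : g.1 1 2 = 0 := by
    have : g.1 1 2 ^ 2 = 0 := by linear_combination -hlow - 2 * hd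
    exact pow_eq_zero_iff two_ne_zero |>.1 this
  have hz : g.1 2 1 = 0 := by
    have : g.1 2 1 ^ 2 = 0 := by linear_combination -hup - 2 * hd
    exact pow_eq_zero_iff two_ne_zero |>.1 this
  have hx : g.1 1 1 = 1 := by
    have : (g.1 1 1 - 1) ^ 2 = 0 := by rw [hy, hz] at hd; linear_combination -hd
    exact sub_eq_zero.1 (pow_eq_zero_iff two_ne_zero |>.1 this)
  have hx1 : g.1 2 2 = 1 := by rw [hx', hx]; norm_num
  refine ⟨g.1 1 0, g.1 2 0, ?_⟩
  apply Subtype.ext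
  ext i j
  fin_cases i <;> fin_cases j <;> simp [cMatrix, h00, h01, h02] <;> assumption

variable (F) in
/-- The group of the matrices `(1, 0, 0; α, 1, 0; δ, 0, 1)`, as a subgroup of `K`. -/
def translations : Subgroup (subK F) where
  carrier := {g | ∃ α δ : F, g.1 = cMatrix α δ 0 1}
  one_mem' := ⟨0, 0, cMatrix_one.symm⟩
  mul_mem' := by
    rintro g h ⟨α, δ, hg⟩ ⟨α', δ', hh⟩
    refine ⟨α + α', δ + δ', ?_⟩
    rw [Subgroup.coe_mul, hg, hh, cMatrix_mul]
    simp
  inv_mem' := by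
    rintro g ⟨α, δ, hg⟩
    refine ⟨-α, -δ, ?_⟩
    rw [Subgroup.coe_inv, hg, inv_eq_iff_mul_eq_one, cMatrix_mul, ← cMatrix_one]
    simp

theorem translations_normal : (translations F).Normal := by
  refine ⟨?_⟩
  rintro r ⟨α, δ, hr⟩ g
  have hgr : ∃ α' δ' : F, g.1 * r.1 = cMatrix α' δ' 0 1 * g.1 := by
    obtain ⟨h00, h01, h02⟩ := g.2
    refine ⟨g.1.1 1 1 * α + g.1.1 1 2 * δ, g.1.1 2 1 * α + g.1.1 2 2 * δ, ?_⟩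
    rw [hr]
    apply Subtype.ext
    rw [Matrix.SpecialLinearGroup.coe_mul, Matrix.SpecialLinearGroup.coe_mul]
    ext i j
    fin_cases i <;> fin_cases j <;>
      simp [cMatrix, Matrix.mul_apply, Fin.sum_univ_three, h00, h01, h02] <;> ring
  obtain ⟨α', δ', h⟩ := hgr
  exact ⟨α', δ', by
    rw [Subgroup.coe_mul, Subgroup.coe_mul, h, Subgroup.coe_inv, mul_inv_cancel_right]⟩

theorem le_translations [CharP F p] [Fact p.Prime] {N : Subgroup (subK F)} (hN : N.Normal)
    (hNp : IsPGroup p N) : N ≤ translations F := by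
  intro g hg
  have htr : ∀ h ∈ N, h.1.1.trace = 3 := by
    intro h hh
    obtain ⟨k, hk⟩ := hNp ⟨h, hh⟩
    have hk' : h.1 ^ p ^ k = 1 := by
      have := congrArg (fun y : N => (y : subK F).1) hk
      simpa using this
    simpa using trace_eq_of_pow_eq_one hk'
  have hconj : ∀ h h' : Matrix.SpecialLinearGroup (Fin 3) F, h ∈ subK F → h * h' = 1 →
      (g.1.1 * (h.1 * g.1.1 * h'.1)).trace = 3 := by
    intro h h' hh hhh
    obtain ⟨k, rfl⟩ : ∃ k : subK F, k.1 = h := ⟨⟨h, hh⟩, rfl⟩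
    have := htr (g * (k * g * k⁻¹)) (N.mul_mem hg (hN.conj_mem g hg k))
    rw [Subgroup.coe_mul, Subgroup.coe_mul, Subgroup.coe_mul, Subgroup.coe_inv,
      inv_eq_iff_mul_eq_one.2 hhh, Matrix.SpecialLinearGroup.coe_mul,
      Matrix.SpecialLinearGroup.coe_mul, Matrix.SpecialLinearGroup.coe_mul] at this
    exact this
  refine eq_translation_of_trace g.2 (htr g hg)
    (hconj (cMatrix 0 0 1 1) (cMatrix 0 0 (-1) 1) ⟨rfl, rfl, rfl⟩ ?_)
    (hconj (upperTransvection 1) (upperTransvection (-1)) ⟨rfl, rfl, rfl⟩ ?_)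
  · rw [cMatrix_mul, ← cMatrix_one]; simp
  · rw [upperTransvection_mul, add_neg_cancel, upperTransvection_zero]

theorem isPGroup_translations [CharP F p] : IsPGroup p (translations F) := by
  rintro ⟨r, α, δ, hr⟩
  refine ⟨1, ?_⟩
  apply Subtype.ext
  apply Subtype.ext
  simp only [pow_one, SubgroupClass.coe_pow, hr, cMatrix_pow_unip, CharP.cast_eq_zero, zero_mul]
  exact cMatrix_one

theorem mem_subW_iff [CharP F p] (hp : p.Prime) (M : Matrix.SpecialLinearGroup (Fin 3) F) :
    M ∈ subW F p ↔ ∃ α δ : F, M = cMatrix α δ 0 1 := by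
  have : Fact p.Prime := ⟨hp⟩
  have hR : pCore p (subK F) = translations F := le_antisymm
    (sSup_le fun N hN => le_translations hN.1 hN.2)
    (le_sSup ⟨translations_normal, isPGroup_translations⟩)
  rw [subW, hR]
  constructor
  · rintro ⟨g, ⟨α, δ, hg⟩, rfl⟩
    exact ⟨α, δ, hg⟩
  · rintro ⟨α, δ, rfl⟩
    exact ⟨⟨cMatrix α δ 0 1, rfl, rfl, rfl⟩, ⟨α, δ, rfl⟩, rfl⟩

end target

/-! ### The polynomials `w(λ)` -/

section wpoly

variable {F : Type*} [Field F] {p m : ℕ}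

theorem natCast_ne_zero_of_lt [CharP F p] {n : ℕ} (h0 : n ≠ 0) (h : n < p) : (n : F) ≠ 0 := by
  rw [Ne, CharP.cast_eq_zero_iff F p]
  exact fun hd => absurd (Nat.le_of_dvd (Nat.pos_of_ne_zero h0) hd) (by omega)

theorem w_coe (lam : F) : (w m lam).1 = ∑ a ∈ Finset.range (m + 1),
    monomial (expo a (m - a)) (lam ^ (a + 1) / ((a : F) + 1) * (m.choose a : F)) := by
  rw [Finset.sum_range, w, AddSubmonoidClass.coe_finsetSum]
  rfl

theorem coeff_w (lam : F) {a b : ℕ} (h : a + b = m) :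
    coeff (expo a b) (w m lam).1 = lam ^ (a + 1) / ((a : F) + 1) * (m.choose a : F) := by
  obtain rfl : b = m - a := by omega
  rw [w_coe, coeff_sum, Finset.sum_eq_single a]
  · simp
  · intro c _ hc
    rw [coeff_monomial, if_neg]
    intro h
    apply hc
    simpa [expo_zero] using congrArg (fun f => f 0) h
  · intro h'; exact absurd (Finset.mem_range.2 (by omega)) h'

theorem coeffY_w (lam : F) : coeffY F m (w m lam) = lam := by
  rw [coeffY_apply, coeff_w lam (zero_add m)]; simp

theorem w_zero : w m (0 : F) = 0 := by
  apply Subtype.ext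
  rw [w_coe]
  refine Finset.sum_eq_zero fun a _ => ?_
  simp

/-- `w(λ)` is the formal integral of `(s X + Y)^m` over `s` from `0` to `λ`. -/
theorem X_mul_w [CharP F p] (hm1 : m + 1 < p) (lam : F) :
    C ((m : F) + 1) * X 0 * (w m lam).1 = (C lam * X 0 + X 1) ^ (m + 1) - X 1 ^ (m + 1) := by
  have h : (C lam * X 0 + X 1 : MvPolynomial (Fin 2) F) ^ (m + 1) = (linPow (m + 1) lam 1).1 := by
    change _ = (C lam * X 0 + C 1 * X 1) ^ (m + 1)
    rw [map_one, one_mul]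
  rw [h, linPow_eq, Finset.sum_range_succ', w_coe, Finset.mul_sum]
  have h0 : (monomial (expo 0 (m + 1 - 0))) (lam ^ 0 * 1 ^ (m + 1 - 0) * ((m + 1).choose 0 : F)) =
      X 1 ^ (m + 1) := by
    rw [monomial_expo]; simp
  rw [h0, add_sub_cancel_right]
  refine Finset.sum_congr rfl fun a ha => ?_
  have ha' := Finset.mem_range.1 ha
  have hne : ((a : F) + 1) ≠ 0 := by
    have := natCast_ne_zero_of_lt (F := F) (p := p) (Nat.succ_ne_zero a) (by omega)
    simpa using this
  have hch : ((m : F) + 1) * m.choose a = (m + 1).choose (a + 1) * ((a : F) + 1) := by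
    exact_mod_cast congrArg (Nat.cast : ℕ → F) (Nat.add_one_mul_choose_eq m a)
  rw [monomial_expo, monomial_expo, show m + 1 - (a + 1) = m - a by omega, one_pow, mul_one]
  have : lam ^ (a + 1) * ((m + 1).choose (a + 1) : F) =
      ((m : F) + 1) * (lam ^ (a + 1) / ((a : F) + 1) * (m.choose a : F)) := by
    field_simp
    linear_combination -lam ^ (a + 1) * hch
  rw [this, map_mul C ((m : F) + 1)]
  ring

/-- The twisted cocycle identity of `w`; the scalar is the one for which `w` is equivariant under
diagonal matrices. -/
theorem smul_act_w [CharP F p] (hm1 : m + 1 < p) (a b : Fˣ) (lam mu : F) :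
    ((a / b ^ (m + 1) : Fˣ) : F) • act (lower a b (b * mu)).1 (w m lam) =
      w m (lam * (a / b) + mu) - w m mu := by
  have hb : (b : F) ≠ 0 := b.ne_zero
  have hm0 : ((m : F) + 1) ≠ 0 := by
    have := natCast_ne_zero_of_lt (F := F) (p := p) (Nat.succ_ne_zero m) hm1
    simpa using this
  have hX : (C ((m : F) + 1) * X 0 : MvPolynomial (Fin 2) F) ≠ 0 :=
    mul_ne_zero ((map_ne_zero_iff _ (C_injective _ _)).2 hm0) (X_ne_zero _)
  apply Subtype.ext
  apply mul_left_cancel₀ hX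
  have h1 := congrArg (subst (lower a b (b * mu)).1) (X_mul_w hm1 lam)
  have hs0 : subst (lower a b (b * mu)).1 (X 0) = C (a : F) * X 0 := by simp [subst]
  have hs1 : subst (lower a b (b * mu)).1 (X 1) = C (b * mu : F) * X 0 + C (b : F) * X 1 := by
    simp [subst]
  rw [map_mul (subst _), map_mul (subst _), map_sub, map_pow, map_pow, map_add (subst _) (_ * _),
    map_mul (subst _) (C lam), hs0, hs1, algHom_C, algHom_C, MvPolynomial.algebraMap_eq] at h1
  rw [Submodule.coe_smul, act_coe, Submodule.coe_sub, mul_sub, X_mul_w hm1, X_mul_w hm1,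
    smul_eq_C_mul]
  have e1 : (C lam * (C (a : F) * X 0) + (C (b * mu : F) * X 0 + C (b : F) * X 1) :
      MvPolynomial (Fin 2) F) = C (b : F) * (C (lam * (a / b) + mu) * X 0 + X 1) := by
    have : C (b : F) * C (lam * (a / b) + mu) =
        (C lam * C (a : F) + C (b : F) * C mu : MvPolynomial (Fin 2) F) := by
      rw [← map_mul, ← map_mul, ← map_mul, ← map_add]
      congr 1
      field_simp
    rw [map_mul C (b : F) mu]
    linear_combination -X 0 * this
  have e2 : (C (b * mu : F) * X 0 + C (b : F) * X 1 : MvPolynomial (Fin 2) F) =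
      C (b : F) * (C mu * X 0 + X 1) := by
    rw [map_mul]; ring
  have e3 : (C ((a / b ^ (m + 1) : Fˣ) : F) * C (b : F) ^ (m + 1) : MvPolynomial (Fin 2) F) =
      C (a : F) := by
    rw [← map_pow, ← map_mul]
    congr 1
    rw [Units.val_div_eq_div_val, Units.val_pow_eq_pow_val]
    field_simp
  rw [e1, e2, mul_pow, mul_pow] at h1
  have ha : (C (a : F) : MvPolynomial (Fin 2) F) ≠ 0 := by simp
  apply mul_left_cancel₀ ha
  linear_combination C ((a / b ^ (m + 1) : Fˣ) : F) * h1 +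
    ((C (lam * (a / b) + mu) * X 0 + X 1) ^ (m + 1) - (C mu * X 0 + X 1) ^ (m + 1)) * e3

/-- The values of the form on the polynomials `w(x)`, from the binomial theorem. -/
theorem form_w_w [CharP F p] (hm2 : m + 2 < p) (hodd : Odd m) (x y : F) :
    form F m (w m x) (w m y) =
      (y ^ (m + 2) - x ^ (m + 2) + (x - y) ^ (m + 2)) / (((m : F) + 1) * ((m : F) + 2)) := by
  have hne : ∀ n : ℕ, n ≤ m + 1 → ((n : F) + 1) ≠ 0 := by
    intro n hn
    have := natCast_ne_zero_of_lt (F := F) (p := p) (Nat.succ_ne_zero n) (by omega)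
    simpa using this
  have h1 := hne m (by omega)
  have h2 : ((m : F) + 2) ≠ 0 := by
    have := hne (m + 1) le_rfl
    rw [Nat.cast_succ] at this
    convert this using 1; ring
  have hodd2 : Odd (m + 2) := hodd.add_even even_two
  have hexp : (x - y) ^ (m + 2) = -((-x) + y) ^ (m + 2) := by
    rw [← hodd2.neg_pow]; ring
  rw [eq_div_iff (mul_ne_zero h1 h2), hexp, add_pow, Finset.sum_range_succ, Finset.sum_range_succ',
    form_apply, Finset.sum_mul]
  simp only [Nat.sub_self, pow_zero, Nat.choose_self, Nat.choose_zero_right, Nat.sub_zero,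
    hodd2.neg_pow x, Nat.cast_one, mul_one, one_mul]
  rw [neg_add, neg_add, neg_neg, ← Finset.sum_neg_distrib]
  have : ∀ s : F, y ^ (m + 2) - x ^ (m + 2) + (s + -y ^ (m + 2) + x ^ (m + 2)) = s := by
    intro s; ring
  rw [this]
  refine Finset.sum_congr rfl fun a ha => ?_
  have ha' : a ≤ m := by have := Finset.mem_range.1 ha; omega
  rw [coeff_w x (by omega), coeff_w y (by omega), Nat.choose_symm ha',
    show m + 2 - (a + 1) = m - a + 1 by omega]
  have hc0 := choose_ne_zero (F := F) (p := p) (m := m) (by omega) ha'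
  have ha1 := hne a (by omega)
  have ha2 := hne (m - a) (by omega)
  have hch1 : ((m : F) + 1) * m.choose a = (m + 1).choose (a + 1) * ((a : F) + 1) := by
    exact_mod_cast congrArg (Nat.cast : ℕ → F) (Nat.add_one_mul_choose_eq m a)
  have hch2 : ((m : F) + 2) * (m + 1).choose (a + 1) =
      (m + 2).choose (a + 1) * (((m - a : ℕ) : F) + 1) := by
    have h := Nat.choose_mul_succ_eq (m + 1) (a + 1)
    rw [show m + 1 + 1 - (a + 1) = m - a + 1 by omega] at h
    have := congrArg (Nat.cast : ℕ → F) h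
    push_cast at this
    linear_combination this
  have hprod : ((m : F) + 1) * ((m : F) + 2) * m.choose a =
      (m + 2).choose (a + 1) * (((m - a : ℕ) : F) + 1) * ((a : F) + 1) := by
    linear_combination ((m : F) + 2) * hch1 + ((a : F) + 1) * hch2
  have hneg : (-x) ^ (a + 1) = -((-1) ^ a * x ^ (a + 1)) := by
    rw [neg_pow x, pow_succ (-1 : F)]; ring
  rw [hneg]
  field_simp
  linear_combination x ^ (a + 1) * y ^ (m - a + 1) * hprod

end wpoly

/-! ### The normalizer of the explicit subgroup `W₀` -/

section normalizer

variable {F : Type*} [Field F] {p m : ℕ} [CharP F p] {hm : m < p}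

theorem nElt_eq_elt (a b : Fˣ) (lam τ θ : F) : nElt hm a b lam τ θ =
    elt hm (a / b ^ (m + 1), lower a b (b * lam)) ⟨w m lam + monoX m τ, θ⟩ := rfl

theorem nElt_injective {a b a' b' : Fˣ} {lam τ θ lam' τ' θ' : F}
    (h : nElt hm a b lam τ θ = nElt hm a' b' lam' τ' θ') :
    a = a' ∧ b = b' ∧ lam = lam' ∧ τ = τ' ∧ θ = θ' := by
  rw [nElt_eq_elt, nElt_eq_elt] at h
  obtain ⟨h1, h2⟩ := elt_injective h
  obtain ⟨rfl, rfl, h3⟩ := lower_injective (congrArg Prod.snd h1)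
  have h4 : lam = lam' := mul_left_cancel₀ b.ne_zero h3
  subst h4
  exact ⟨rfl, rfl, rfl, monoX_injective (add_left_cancel (congrArg Q.v h2)), congrArg Q.z h2⟩

theorem nElt_mul (hm1 : m + 1 < p) (a b a' b' : Fˣ) (lam τ θ lam' τ' θ' : F) :
    nElt hm a b lam τ θ * nElt hm a' b' lam' τ' θ' =
      nElt hm (a * a') (b * b') (lam * (a' / b') + lam') ((a' / b') ^ (m + 1) * τ + τ')
        ((a' / b') ^ (m + 2) * θ + θ' +
          form F m (w m (lam * (a' / b') + lam') - w m lam' + monoX m ((a' / b') ^ (m + 1) * τ))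
            (w m lam' + monoX m τ')) := by
  have ha' : (a' : F) ≠ 0 := a'.ne_zero
  have hb' : (b' : F) ≠ 0 := b'.ne_zero
  rw [nElt_eq_elt, nElt_eq_elt, nElt_eq_elt, elt_mul]
  have hv : ((a' / b' ^ (m + 1) : Fˣ) : F) •
      act (lower a' b' (b' * lam')).1 (w m lam + monoX m τ) =
      w m (lam * (a' / b') + lam') - w m lam' + monoX m ((a' / b') ^ (m + 1) * τ) := by
    rw [map_add, smul_add, smul_act_w hm1, act_lower_monoX, smul_monoX, ← mul_assoc]
    congr 3
    rw [Units.val_div_eq_div_val, Units.val_pow_eq_pow_val, div_pow]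
    field_simp
    ring
  have key : ∀ A B C D : V F m, A - B + C + (B + D) = A + (C + D) := by
    intros; abel
  congr 1
  · rw [Prod.mk_mul_mk, lower_mul, mul_pow, div_mul_div_comm]
    congr 2
    rw [Units.val_mul]
    field_simp
  · apply Q.ext
    · rw [Q.mul_v, rightAct_v, hv, monoX_add]
      exact key _ _ _ _
    · rw [Q.mul_z, rightAct_z, rightAct_v, hv, det_lower]
      congr 3
      rw [Units.val_div_eq_div_val, Units.val_pow_eq_pow_val, div_pow _ _ (m + 2)]
      field_simp
      ring

theorem nElt_one : nElt hm 1 1 (0 : F) 0 0 = 1 := by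
  rw [nElt_eq_elt, w_zero, monoX_zero, zero_add, mul_zero, one_pow, div_one, unip_zero]
  exact elt_one

theorem mem_W0_iff (hm1 : m + 1 < p) {x : P F hm} :
    x ∈ W0 F hm ↔ ∃ γ δ : F, x = nElt hm 1 1 γ 0 δ := by
  have hgen : ∀ γ δ : F, (SemidirectProduct.inr (1, lower 1 1 γ) *
      SemidirectProduct.inl ⟨w m γ, δ⟩ : P F hm) = nElt hm 1 1 γ 0 δ := by
    intro γ δ
    rw [nElt_eq_elt, monoX_zero, add_zero, one_pow, div_one, Units.val_one, one_mul]
    rfl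
  have hmul : ∀ γ δ γ' δ' : F, nElt hm 1 1 γ 0 δ * nElt hm 1 1 γ' 0 δ' =
      nElt hm 1 1 (γ + γ') 0 (δ + δ' + form F m (w m (γ + γ') - w m γ') (w m γ')) := by
    intro γ δ γ' δ'
    rw [nElt_mul hm1]
    simp [monoX_zero]
  constructor
  · intro hx
    induction hx using Subgroup.closure_induction with
    | mem x hx =>
      obtain ⟨γ, δ, rfl⟩ := hx
      exact ⟨γ, δ, hgen γ δ⟩
    | one => exact ⟨0, 0, nElt_one.symm⟩
    | mul x y _ _ hx hy =>
      obtain ⟨γ, δ, rfl⟩ := hx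
      obtain ⟨γ', δ', rfl⟩ := hy
      exact ⟨_, _, hmul _ _ _ _⟩
    | inv x _ hx =>
      obtain ⟨γ, δ, rfl⟩ := hx
      refine ⟨-γ, -δ - form F m (w m (γ + -γ) - w m (-γ)) (w m (-γ)), ?_⟩
      rw [inv_eq_iff_mul_eq_one, hmul, ← nElt_one]
      congr 1 <;> ring
  · rintro ⟨γ, δ, rfl⟩
    rw [← hgen]
    exact Subgroup.subset_closure ⟨γ, δ, rfl⟩

theorem W0_le_sylowP (hm1 : m + 1 < p) : W0 F hm ≤ sylowP F hm := by
  intro x hx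
  obtain ⟨γ, δ, rfl⟩ := (mem_W0_iff hm1).1 hx
  rw [mem_sylowP]
  exact ⟨γ, ⟨w m γ + monoX m 0, δ⟩, by simp [nElt_eq_elt]⟩

theorem nElt_conj (hm1 : m + 1 < p) (a b : Fˣ) (lam τ θ γ δ : F) : ∃ γ' δ' : F,
    nElt hm a b lam τ θ * nElt hm 1 1 γ 0 δ = nElt hm 1 1 γ' 0 δ' * nElt hm a b lam τ θ := by
  have ha : (a : F) ≠ 0 := a.ne_zero
  have hb : (b : F) ≠ 0 := b.ne_zero
  have hab : ((a : F) / b) ^ (m + 2) ≠ 0 := pow_ne_zero _ (div_ne_zero ha hb)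
  -- the parameter `δ'` solves a linear equation for the last coordinate
  obtain ⟨δ', hδ'⟩ : ∃ δ' : F, θ + δ + form F m (w m (lam + γ) - w m γ + monoX m τ) (w m γ) =
      ((a : F) / b) ^ (m + 2) * δ' + θ +
        form F m (w m (lam + γ) - w m lam) (w m lam + monoX m τ) :=
    ⟨(δ + form F m (w m (lam + γ) - w m γ + monoX m τ) (w m γ) -
      form F m (w m (lam + γ) - w m lam) (w m lam + monoX m τ)) / ((a : F) / b) ^ (m + 2), by
      rw [mul_div_cancel₀ _ hab]; ring⟩
  refine ⟨γ * (b / a), δ', ?_⟩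
  have e : γ * ((b : F) / a) * (a / b) + lam = lam + γ := by field_simp; ring
  rw [nElt_mul hm1, nElt_mul hm1, e]
  simp only [Units.val_one, div_one, one_pow, one_mul, mul_one, mul_zero, monoX_zero, add_zero,
    zero_add, hδ']

/-- If `A` conjugates a nontrivial unipotent lower triangular matrix to such a matrix, then `A`
is lower triangular. -/
theorem zero_one_of_conj {A : GL (Fin 2) F} {γ γ' : F} (hγ : γ ≠ 0)
    (h : A * lower 1 1 γ = lower 1 1 γ' * A) : A.1 0 1 = 0 := by
  have := congrArg (fun B : GL (Fin 2) F => B.1 0 0) h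
  simpa [Matrix.mul_apply, Fin.sum_univ_two, hγ] using this

variable [Finite F]

instance : Finite (V F m) := by
  refine Finite.of_injective
    (fun (v : V F m) (a : Fin (m + 1)) => coeff (expo (m - a) a) v.1) fun v v' h => ?_
  apply Subtype.ext
  rw [eq_sum v, eq_sum v']
  refine Finset.sum_congr rfl fun a ha => ?_
  have := congrFun h ⟨a, Finset.mem_range.1 ha⟩
  simp only at this
  rw [this]

instance : Finite (Q F m) :=
  Finite.of_injective (fun x : Q F m => (x.v, x.z)) fun _ _ h =>
    Q.ext (congrArg Prod.fst h) (congrArg Prod.snd h)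

instance : Finite (P F hm) := Finite.of_equiv _ SemidirectProduct.equivProd.symm

theorem nElt_mem_normW0 (hm1 : m + 1 < p) (a b : Fˣ) (lam τ θ : F) :
    nElt hm a b lam τ θ ∈ normW0 F hm := by
  refine Subgroup.mem_normalizer_fintype fun x hx => ?_
  obtain ⟨γ, δ, rfl⟩ := (mem_W0_iff hm1).1 hx
  obtain ⟨γ', δ', h⟩ := nElt_conj (hm := hm) hm1 a b lam τ θ γ δ
  rw [h, mul_inv_cancel_right]
  exact (mem_W0_iff hm1).2 ⟨γ', δ', rfl⟩

/-- Modulo the known normalizing elements, an element of the normalizer is `(t, 1) (v, z)`.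
Conjugating `W₀` it fixes each `γ`, and the coefficient of `Y^m` gives `t = 1`; then `v` is fixed
by the unipotent matrices, so `v` is a multiple of `X^m`. -/
theorem mem_normW0_iff (hm1 : m + 1 < p) (x : P F hm) :
    x ∈ normW0 F hm ↔ ∃ (a b : Fˣ) (lam τ θ : F), x = nElt hm a b lam τ θ := by
  constructor
  swap
  · rintro ⟨a, b, lam, τ, θ, rfl⟩
    exact nElt_mem_normW0 hm1 a b lam τ θ
  intro hx
  -- the image of the generator with `γ = 1` under conjugation
  have hconj : ∀ y ∈ normW0 F hm, ∃ γ δ : F,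
      y * nElt hm 1 1 1 0 0 = nElt hm 1 1 γ 0 δ * y := by
    intro y hy
    have h := (Subgroup.mem_normalizer_iff.1 hy _).1 ((mem_W0_iff hm1).2 ⟨1, 0, rfl⟩)
    obtain ⟨γ, δ, h⟩ := (mem_W0_iff hm1).1 h
    exact ⟨γ, δ, by rw [← h, inv_mul_cancel_right]⟩
  obtain ⟨q, hq⟩ := eq_elt x
  obtain ⟨γ, δ, h⟩ := hconj x hx
  rw [hq, nElt_eq_elt, nElt_eq_elt, elt_mul, elt_mul] at h
  have hA := congrArg Prod.snd (elt_injective h).1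
  simp only [Prod.snd_mul, Units.val_one, one_mul] at hA
  obtain ⟨a, b, c, hlow⟩ := eq_lower _ (zero_one_of_conj one_ne_zero hA)
  have hb : (b : F) ≠ 0 := b.ne_zero
  set y := nElt hm a b (c / b) 0 0 with hy
  have hyN : y ∈ normW0 F hm := nElt_mem_normW0 hm1 _ _ _ _ _
  obtain ⟨r, hr⟩ := eq_elt (x * y⁻¹)
  have hright : (x * y⁻¹).right = (x.right.1 * (a / b ^ (m + 1))⁻¹, 1) := by
    rw [SemidirectProduct.mul_right, SemidirectProduct.inv_right, hy, nElt_eq_elt, elt_right,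
      mul_div_cancel₀ _ hb, ← hlow]
    exact Prod.ext rfl (mul_inv_cancel _)
  rw [hright] at hr
  set t := x.right.1 * (a / b ^ (m + 1))⁻¹
  obtain ⟨γ, δ, h⟩ := hconj _ ((normW0 F hm).mul_mem hx ((normW0 F hm).inv_mem hyN))
  rw [hr, nElt_eq_elt, nElt_eq_elt, elt_mul, elt_mul] at h
  obtain ⟨h1, h2⟩ := elt_injective h
  have hγ : γ = 1 := by
    have := congrArg Prod.snd h1
    simp only [Prod.snd_mul, Units.val_one, one_mul, mul_one] at this
    exact (lower_injective this).2.2.symm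
  subst hγ
  have h3 := congrArg Q.v h2
  simp only [Q.mul_v, rightAct_v, one_pow, div_one, Units.val_one, one_smul, monoX_zero, add_zero,
    one_mul, act_one] at h3
  have ht : (t : F) = 1 := by
    have h4 := congrArg (coeffY F m) h3
    rw [map_add, map_add, coeffY_act_lower, map_smul, coeffY_w, Units.val_one, one_pow, one_mul,
      smul_eq_mul, mul_one, add_comm] at h4
    exact (add_right_cancel h4).symm
  rw [ht, one_smul, add_comm] at h3
  obtain ⟨τ, hτ⟩ := eq_monoX_of_fixed hm one_ne_zero (add_left_cancel h3)
  have hk : x * y⁻¹ = nElt hm 1 1 0 τ r.z := by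
    rw [hr, nElt_eq_elt, w_zero, zero_add, ← hτ, mul_zero, lower_one, one_pow, div_one,
      show t = 1 from Units.ext ht]
  have hxy : x = nElt hm 1 1 0 τ r.z * y := by rw [← hk, inv_mul_cancel_right]
  rw [hy, nElt_mul hm1] at hxy
  exact ⟨_, _, _, _, _, hxy⟩

end normalizer

/-! ### The homomorphism `Θ` -/

section theta

variable {F : Type*} [Field F] {p m : ℕ} [CharP F p] {hm : m < p}

theorem thetaVal_mem (a b : Fˣ) (lam τ θ : F) : thetaVal m a b lam τ θ ∈ subC F :=
  ⟨_, _, _, _, rfl⟩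

/-- The form in the product of two elements of the normalizer, made explicit. -/
theorem form_cocycle (hm2 : m + 2 < p) (hodd : Odd m) (mu lam s t : F) :
    form F m (w m (mu + lam) - w m lam + monoX m s) (w m lam + monoX m t) =
      (lam ^ (m + 2) - (mu + lam) ^ (m + 2) + mu ^ (m + 2)) / (((m : F) + 1) * ((m : F) + 2)) +
        t * mu - s * lam := by
  simp only [map_add, map_sub, LinearMap.add_apply, LinearMap.sub_apply,
    form_w_w hm2 hodd, form_monoX_left hodd, form_monoX_right, coeffY_w,
    coeffY_monoX hodd.pos.ne']
  ring

/-- Multiplicativity of `Θ`. Since `|F^×| = m + 3`, the powers `r^(m+1)` and `r^(m+2)` in the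
multiplication of the normalizer are `r^(-2)` and `r^(-1)`. -/
theorem thetaVal_mul (hp : p = m + 4) (hodd : Odd m)
    (hF : ∀ r : F, r ≠ 0 → r ^ (m + 3) = 1) (a b a' b' : Fˣ) (lam τ θ lam' τ' θ' : F) :
    thetaVal m (a * a') (b * b') (lam * (a' / b') + lam') ((a' / b') ^ (m + 1) * τ + τ')
        ((a' / b') ^ (m + 2) * θ + θ' +
          form F m (w m (lam * (a' / b') + lam') - w m lam' + monoX m ((a' / b') ^ (m + 1) * τ))
            (w m lam' + monoX m τ')) =
      thetaVal m a b lam τ θ * thetaVal m a' b' lam' τ' θ' := by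
  have ha : (a : F) ≠ 0 := a.ne_zero
  have hb : (b : F) ≠ 0 := b.ne_zero
  have ha' : (a' : F) ≠ 0 := a'.ne_zero
  have hb' : (b' : F) ≠ 0 := b'.ne_zero
  have hr : ((a' : F) / b') ≠ 0 := div_ne_zero ha' hb'
  have hr2 : ((a' : F) / b') ^ (m + 2) = b' / a' := by
    have := hF _ hr
    rw [pow_succ] at this
    rw [eq_div_iff ha']
    field_simp at this ⊢
    linear_combination this
  have hr1 : ((a' : F) / b') ^ (m + 1) = (b' / a') ^ 2 := by
    rw [pow_succ] at hr2
    apply mul_right_cancel₀ hr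
    rw [hr2]
    field_simp
  rw [form_cocycle (p := p) (by omega) hodd, mul_pow lam, hr1, hr2, thetaVal, thetaVal, thetaVal,
    cMatrix_mul]
  generalize hc : ((m : F) + 1) * ((m : F) + 2) = c
  generalize hl : lam ^ (m + 2) = L
  generalize hl' : lam' ^ (m + 2) = L'
  generalize (lam * ((a' : F) / b') + lam') ^ (m + 2) = L''
  congr 1
  · simp only [Units.val_mul, Units.val_div_eq_div_val]
    field_simp
  · simp only [Units.val_mul, Units.val_div_eq_div_val, inv_div]
    simp only [div_eq_mul_inv _ c]
    generalize c⁻¹ = d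
    field_simp
    ring
  · simp only [Units.val_mul, Units.val_div_eq_div_val, inv_div]
    field_simp
    ring
  · rw [mul_div_mul_comm]

theorem scalar_eq_nElt (a : Fˣ) : (SemidirectProduct.inr (a / a ^ (m + 1), lower a a 0) :
    P F hm) = nElt hm a a 0 0 0 := by
  rw [nElt_eq_elt, w_zero, monoX_zero, zero_add, mul_zero, inr_eq_elt]; rfl

variable [Finite F]

omit [CharP F p] in
theorem pow_eq_one_of_card (hp : p = m + 4) (hcard : Nat.card F = p) (r : F) (hr : r ≠ 0) :
    r ^ (m + 3) = 1 := by
  have := Fintype.ofFinite F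
  have h := FiniteField.pow_card_sub_one_eq_one r hr
  rwa [← Nat.card_eq_fintype_card, hcard, hp] at h

theorem exists_theta (hp : p = m + 4) (hodd : Odd m) (hcard : Nat.card F = p) :
    ∃ Θ : normW0 F hm →* subC F, ∀ (a b : Fˣ) (lam τ θ : F)
      (h : nElt hm a b lam τ θ ∈ normW0 F hm),
      (Θ ⟨_, h⟩ : Matrix.SpecialLinearGroup (Fin 3) F) = thetaVal m a b lam τ θ := by
  have hm1 : m + 1 < p := by omega
  choose a b lam τ θ hx using fun x : normW0 F hm => (mem_normW0_iff hm1 x.1).1 x.2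
  have huniq : ∀ (x : normW0 F hm) (a' b' : Fˣ) (lam' τ' θ' : F),
      x.1 = nElt hm a' b' lam' τ' θ' →
      thetaVal m (a x) (b x) (lam x) (τ x) (θ x) = thetaVal m a' b' lam' τ' θ' := by
    intro x a' b' lam' τ' θ' h
    obtain ⟨h1, h2, h3, h4, h5⟩ := nElt_injective ((hx x).symm.trans h)
    rw [h1, h2, h3, h4, h5]
  refine ⟨MonoidHom.mk' (fun x => ⟨thetaVal m (a x) (b x) (lam x) (τ x) (θ x),
    thetaVal_mem _ _ _ _ _⟩) ?_, ?_⟩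
  · intro x y
    apply Subtype.ext
    rw [Subgroup.coe_mul, ← thetaVal_mul hp hodd (pow_eq_one_of_card hp hcard)]
    refine huniq _ _ _ _ _ _ ?_
    rw [Subgroup.coe_mul, ← nElt_mul hm1, ← hx, ← hx]
  · intro a' b' lam' τ' θ' h
    exact huniq _ _ _ _ _ _ rfl

theorem theta_surjective (hp2 : p ≠ 2) (hm1 : m + 1 < p) {Θ : normW0 F hm →* subC F}
    (hΘ : ∀ (a b : Fˣ) (lam τ θ : F) (h : nElt hm a b lam τ θ ∈ normW0 F hm),
      (Θ ⟨_, h⟩ : Matrix.SpecialLinearGroup (Fin 3) F) = thetaVal m a b lam τ θ) :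
    Function.Surjective Θ := by
  have h2 : (2 : F) ≠ 0 := two_ne_zero_of_char hp2
  rintro ⟨_, α, δ, ε, θ, rfl⟩
  have hθ : (θ : F) ≠ 0 := θ.ne_zero
  refine ⟨⟨nElt hm 1 θ (α / θ) (-(ε * θ) / 2)
    (δ * θ - (α / θ) ^ (m + 2) / (((m : F) + 1) * ((m : F) + 2)) + α / θ * (-(ε * θ) / 2)),
    nElt_mem_normW0 hm1 _ _ _ _ _⟩, ?_⟩
  apply Subtype.ext
  rw [hΘ, thetaVal]
  generalize (α / θ) ^ (m + 2) / (((m : F) + 1) * ((m : F) + 2)) = c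
  congr 1
  · rw [Units.val_one]; field_simp
  · rw [Units.val_one]; field_simp; ring
  · rw [Units.val_one]; field_simp
  · rw [div_one]

theorem theta_ker (hp2 : p ≠ 2) (hodd : Odd m) (hm1 : m + 1 < p) {Θ : normW0 F hm →* subC F}
    (hΘ : ∀ (a b : Fˣ) (lam τ θ : F) (h : nElt hm a b lam τ θ ∈ normW0 F hm),
      (Θ ⟨_, h⟩ : Matrix.SpecialLinearGroup (Fin 3) F) = thetaVal m a b lam τ θ) :
    Θ.ker = (CLQ F hm).subgroupOf (normW0 F hm) := by
  have h2 : (2 : F) ≠ 0 := two_ne_zero_of_char hp2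
  ext ⟨x, hx⟩
  rw [MonoidHom.mem_ker, Subgroup.mem_subgroupOf]
  constructor
  · intro h
    obtain ⟨a, b, lam, τ, θ, rfl⟩ := (mem_normW0_iff hm1 x).1 hx
    have h1 := congrArg Subtype.val h
    rw [hΘ, OneMemClass.coe_one, ← cMatrix_one, thetaVal] at h1
    obtain ⟨e1, e2, e3, e4⟩ := cMatrix_injective h1
    obtain rfl : b = a := div_eq_one.1 e4
    have hb : (b : F) ≠ 0 := b.ne_zero
    simp only [div_self hb, one_mul, mul_one, mul_eq_zero, neg_eq_zero, h2, false_or] at e1 e2 e3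
    subst e1 e3
    rw [zero_pow (by omega), zero_div, zero_mul, add_zero, sub_zero] at e2
    subst e2
    have hs := scalar_mem_CLQ (hm := hm) b
    rw [scalar_eq_nElt] at hs
    exact hs
  · intro h
    obtain ⟨a, ha⟩ := eq_scalar_of_mem_CLQ hodd.pos.ne' h
    rw [scalar_eq_nElt] at ha
    simp only at ha
    subst ha
    apply Subtype.ext
    rw [hΘ, OneMemClass.coe_one, ← cMatrix_one, thetaVal]
    congr 1 <;> simp

end theta

/-! ### Passing to the quotient by the centre -/

section quotient

theorem exists_mulEquiv_of_ker_eq {G H : Type*} [Group G] [Group H] {N Z : Subgroup G} [Z.Normal]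
    {M : Subgroup (G ⧸ Z)} (hM : ∀ g, QuotientGroup.mk' Z g ∈ M ↔ g ∈ N) (Θ : N →* H)
    (hsurj : Function.Surjective Θ) (hker : Θ.ker = Z.subgroupOf N) :
    ∃ e : M ≃* H, ∀ x : N, ∃ h : QuotientGroup.mk' Z x.1 ∈ M, e ⟨_, h⟩ = Θ x := by
  let ψ : N →* M := ((QuotientGroup.mk' Z).comp N.subtype).codRestrict M fun x => (hM x).2 x.2
  have hψ : Function.Surjective ψ := by
    rintro ⟨y, hy⟩
    obtain ⟨g, rfl⟩ := QuotientGroup.mk'_surjective Z y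
    exact ⟨⟨g, (hM g).1 hy⟩, rfl⟩
  have hk : ψ.ker = Θ.ker := by
    rw [hker]
    ext x
    rw [MonoidHom.mem_ker, Subgroup.mem_subgroupOf, Subtype.ext_iff]
    exact QuotientGroup.eq_one_iff _
  refine ⟨(QuotientGroup.quotientKerEquivOfSurjective ψ hψ).symm.trans
    ((QuotientGroup.quotientMulEquivOfEq hk).trans
      (QuotientGroup.quotientKerEquivOfSurjective Θ hsurj)), fun x => ⟨(hM x).2 x.2, ?_⟩⟩
  have : (QuotientGroup.quotientKerEquivOfSurjective ψ hψ).symm ⟨_, (hM x).2 x.2⟩ =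
      QuotientGroup.mk x := by
    rw [MulEquiv.symm_apply_eq]; rfl
  rw [MulEquiv.trans_apply, this]; rfl

variable {F : Type*} [Field F] {p m : ℕ} [CharP F p] {hm : m < p}

theorem modCenter_map_mk (hm0 : m ≠ 0) (W : Subgroup (P F hm)) :
    modCenter (W.map (QuotientGroup.mk' (CLQ F hm))) =
      W.map (QuotientGroup.mk' (Subgroup.center (P F hm))) := by
  ext y
  constructor
  · rintro ⟨x, ⟨v, hv, hvx⟩, rfl⟩
    obtain ⟨z, hz, rfl⟩ := (QuotientGroup.mk'_eq_mk' _).1 hvx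
    exact ⟨v, hv, (QuotientGroup.mk'_eq_mk' _).2 ⟨z, CLQ_le_center hm0 hz, rfl⟩⟩
  · rintro ⟨x, hx, rfl⟩
    exact ⟨x, ⟨x, hx, rfl⟩, rfl⟩

theorem mem_imageUnder_iff {W₀ : Subgroup (P F hm ⧸ CLQ F hm)} {e : normBar W₀ ≃* subC F}
    {M : Matrix.SpecialLinearGroup (Fin 3) F} :
    M ∈ imageUnder W₀ e ↔ ∃ y : normBar W₀, y.1 ∈ modCenter W₀ ∧ (e y).1 = M := by
  constructor
  · rintro ⟨_, ⟨y, hy, rfl⟩, rfl⟩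
    exact ⟨y, hy, rfl⟩
  · rintro ⟨y, hy, rfl⟩
    exact ⟨_, ⟨y, hy, rfl⟩, rfl⟩

variable [Finite F]

/-- The isomorphism `N_{P/Z(P)}(W₀ Z(P) / Z(P)) ≅ C` induced by `Θ`. -/
theorem exists_equiv_of_theta (hp : p.Prime) (hp2 : p ≠ 2) (hodd : Odd m) (hm1 : m + 1 < p)
    {Θ : normW0 F hm →* subC F}
    (hΘ : ∀ (a b : Fˣ) (lam τ θ : F) (h : nElt hm a b lam τ θ ∈ normW0 F hm),
      (Θ ⟨_, h⟩ : Matrix.SpecialLinearGroup (Fin 3) F) = thetaVal m a b lam τ θ) :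
    ∃ e : normBar (W0bar F hm) ≃* subC F,
      (∀ x : normW0 F hm, ∃ h : QuotientGroup.mk' (Subgroup.center (P F hm)) x.1 ∈
          normBar (W0bar F hm), e ⟨_, h⟩ = Θ x) ∧
      imageUnder (W0bar F hm) e = subW F p := by
  have hmod := modCenter_map_mk hodd.pos.ne' (W0 F hm)
  have hM : ∀ g : P F hm, QuotientGroup.mk' (Subgroup.center (P F hm)) g ∈
      normBar (W0bar F hm) ↔ g ∈ normW0 F hm := by
    intro g
    rw [normBar, hmod]
    exact mem_normalizer_map_mk_iff (fun z hz k hk => eq_one_of_mem_center hp2 hodd hz hk)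
      (fun x hx => pow_eq_one_of_mem_sylowP (W0_le_sylowP hm1 hx)) g
  obtain ⟨e, he⟩ := exists_mulEquiv_of_ker_eq hM Θ (theta_surjective hp2 hm1 hΘ)
    ((theta_ker hp2 hodd hm1 hΘ).trans (by rw [center_eq_CLQ hp2 hodd]))
  refine ⟨e, he, ?_⟩
  ext M
  rw [mem_imageUnder_iff, mem_subW_iff hp]
  have hval : ∀ γ δ : F, thetaVal m 1 1 γ 0 δ =
      cMatrix γ (δ + γ ^ (m + 2) / (((m : F) + 1) * ((m : F) + 2))) 0 1 := by
    intro γ δ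
    rw [thetaVal]
    congr 1 <;> simp
  constructor
  · rintro ⟨⟨y, hy⟩, hyW, rfl⟩
    simp only [hmod] at hyW
    obtain ⟨x, hx, rfl⟩ := hyW
    obtain ⟨γ, δ, rfl⟩ := (mem_W0_iff hm1).1 hx
    obtain ⟨_, h⟩ := he ⟨_, (hM _).1 hy⟩
    exact ⟨_, _, (congrArg Subtype.val h).trans ((hΘ _ _ _ _ _ _).trans (hval γ δ))⟩
  · rintro ⟨α, δ, rfl⟩
    have hN := nElt_mem_normW0 (hm := hm) hm1 1 1 α 0
      (δ - α ^ (m + 2) / (((m : F) + 1) * ((m : F) + 2)))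
    obtain ⟨h, hh⟩ := he ⟨_, hN⟩
    refine ⟨⟨_, h⟩, ?_, ?_⟩
    · rw [hmod]
      exact Subgroup.mem_map_of_mem _ ((mem_W0_iff hm1).2 ⟨_, _, rfl⟩)
    · rw [hh, hΘ, hval, sub_add_cancel]

end quotient

/-! ### Semilinear maps of finite fields -/

section fields

variable {F : Type*} [Field F] [Finite F] {p : ℕ} [CharP F p]

/-- If a nonzero additive map intertwines the multiplications by `a` and by `b`, then `a` and `b`
have the same minimal polynomial over the prime field, so each of them is a Frobenius power of
the other. -/
theorem exists_frobenius_of_intertwines (hp : p.Prime) (f : F →+ F) (hf : f ≠ 0) {a b : F}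
    (h : ∀ x, f (a * x) = b * f x) : (∃ j : ℕ, b = a ^ p ^ j) ∧ ∃ j : ℕ, a = b ^ p ^ j := by
  have : Fact p.Prime := ⟨hp⟩
  let _ : Algebra (ZMod p) F := ZMod.algebra F p
  let f' : F →ₗ[ZMod p] F := f.toZModLinearMap p
  have key : ∀ (q : Polynomial (ZMod p)) (x : F),
      f' (Polynomial.aeval a q * x) = Polynomial.aeval b q * f' x := by
    intro q
    induction q using Polynomial.induction_on' with
    | add q r hq hr => intro x; rw [map_add, map_add, add_mul, add_mul, map_add, hq, hr]
    | monomial n c =>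
      intro x
      have hn : ∀ n : ℕ, ∀ x, f' (a ^ n * x) = b ^ n * f' x := by
        intro n
        induction n with
        | zero => simp
        | succ n ih => intro x; rw [pow_succ, mul_assoc, ih, pow_succ, mul_assoc]; congr 1; exact h x
      rw [Polynomial.aeval_monomial, Polynomial.aeval_monomial, mul_assoc, mul_assoc,
        ← Algebra.smul_def, ← Algebra.smul_def, map_smul, hn]
  obtain ⟨x, hx⟩ : ∃ x, f x ≠ 0 := by
    by_contra! hc
    exact hf (AddMonoidHom.ext hc)
  have hroot : Polynomial.aeval b (minpoly (ZMod p) a) = 0 := by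
    have := key (minpoly (ZMod p) a) x
    rw [minpoly.aeval, zero_mul, map_zero] at this
    exact (mul_eq_zero.1 this.symm).resolve_right hx
  have hint : IsIntegral (ZMod p) a := Algebra.IsIntegral.isIntegral a
  have hmin : minpoly (ZMod p) a = minpoly (ZMod p) b :=
    minpoly.eq_of_irreducible_of_monic (minpoly.irreducible hint) hroot (minpoly.monic hint)
  have hpow : ∀ {x y : F}, IsConjRoot (ZMod p) x y → ∃ j : ℕ, x = y ^ p ^ j := by
    intro x y hxy
    obtain ⟨σ, hσ⟩ := isConjRoot_iff_exists_algEquiv.1 hxy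
    obtain ⟨j, hj⟩ := (FiniteField.bijective_frobeniusAlgEquivOfAlgebraic_pow (ZMod p) F).2 σ
    refine ⟨j, ?_⟩
    rw [← hσ, ← hj]
    simp only
    rw [AlgEquiv.coe_pow, FiniteField.coe_frobeniusAlgEquivOfAlgebraic_iterate, ZMod.card]
  exact ⟨hpow (IsConjRoot.symm hmin), hpow hmin⟩

/-- A generator `λ` of `F^×` with `λ^(m + 2 p^j + p^k) = 1`, where `m ≤ p - 2` and `p ≥ 5`: after
reduction of `j` and `k` modulo the degree `n` of `F`, the exponent is less than `p^n - 1` unless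
`n = 1`, and less than `2 (p - 1)` then. -/
theorem card_eq_of_pow_eq_one (hp : p.Prime) (hp5 : 5 ≤ p) {m : ℕ} (hm1 : m + 1 < p) {x : F}
    (hx : ∀ n : ℕ, x ^ n = 1 → Nat.card F - 1 ∣ n) {j k : ℕ}
    (h : x ^ m * (x ^ p ^ j) ^ 2 * x ^ p ^ k = 1) : Nat.card F = p ∧ p = m + 4 := by
  have := Fintype.ofFinite F
  obtain ⟨n, -, hn⟩ := FiniteField.card F p
  have hcard : Nat.card F = p ^ (n : ℕ) := by rw [Nat.card_eq_fintype_card, hn]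
  have hn0 : 0 < (n : ℕ) := n.pos
  have hred : ∀ s : ℕ, x ^ p ^ s = x ^ p ^ (s % n) := by
    intro s
    have hs : ∀ r : ℕ, x ^ p ^ (n * r) = x := by
      intro r
      induction r with
      | zero => simp
      | succ r ih => rw [mul_add, mul_one, pow_add, pow_mul, ih, ← hn, FiniteField.pow_card]
    conv_lhs => rw [← Nat.div_add_mod s n, pow_add, pow_mul, hs]
  rw [hred j, hred k, ← pow_mul, ← pow_add, ← pow_add] at h
  have hj := Nat.mod_lt j hn0
  have hk := Nat.mod_lt k hn0
  have hdvd := hx _ h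
  rw [hcard] at hdvd ⊢
  generalize (n : ℕ) = n at *
  have hle : ∀ s, s < n → p ^ s ≤ p ^ (n - 1) := fun s hs => Nat.pow_le_pow_right hp.pos (by omega)
  have hj' := hle _ hj
  have hk' := hle _ hk
  have hbig := Nat.le_of_dvd (by have := hp.pos; positivity) hdvd
  have hpn : p ^ n = p ^ (n - 1) * p := by rw [← pow_succ]; congr 1; omega
  have h5 : p ^ (n - 1) * 5 ≤ p ^ (n - 1) * p := Nat.mul_le_mul_left _ hp5
  have hn1 : n = 1 := by
    by_contra hne
    have h1 : p ^ 1 ≤ p ^ (n - 1) := Nat.pow_le_pow_right hp.pos (by omega)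
    rw [pow_one] at h1
    omega
  subst hn1
  simp only [Nat.lt_one_iff.1 hj, Nat.lt_one_iff.1 hk, pow_zero, pow_one] at hdvd
  refine ⟨pow_one p, ?_⟩
  obtain ⟨c, hc⟩ := hdvd
  have hc2 : c < 2 := by
    by_contra hcc
    have : (p - 1) * 2 ≤ (p - 1) * c := Nat.mul_le_mul_left _ (by omega)
    omega
  interval_cases c <;> omega

end fields

/-! ### Reduction to a subgroup of the Sylow subgroup -/

section reduction

variable {F : Type*} [Field F] {p m : ℕ}

/-- The element `(1, 0, 0; α, θ, 0; δ, ε, θ⁻¹)` of `C`. -/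
def cElt (α δ ε : F) (θ : Fˣ) : subC F := ⟨cMatrix α δ ε θ, α, δ, ε, θ, rfl⟩

/-- The element `(1, 0, 0; α, 1, 0; δ, 0, 1)` of `W`, as an element of `C`. -/
def wElt (α δ : F) : subC F := cElt α δ 0 1

theorem cElt_mul (α δ ε α' δ' ε' : F) (θ θ' : Fˣ) :
    cElt α δ ε θ * cElt α' δ' ε' θ' =
      cElt (α + θ * α') (δ + ε * α' + (θ⁻¹ : Fˣ) * δ') (ε * θ' + (θ⁻¹ : Fˣ) * ε') (θ * θ') :=
  Subtype.ext (cMatrix_mul _ _ _ _ _ _ _ _)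

theorem cElt_injective {α δ ε α' δ' ε' : F} {θ θ' : Fˣ}
    (h : cElt α δ ε θ = cElt α' δ' ε' θ') : α = α' ∧ δ = δ' ∧ ε = ε' ∧ θ = θ' :=
  cMatrix_injective (congrArg Subtype.val h)

theorem exists_eq_cElt (c : subC F) : ∃ (α δ ε : F) (θ : Fˣ), c = cElt α δ ε θ := by
  obtain ⟨_, α, δ, ε, θ, rfl⟩ := c
  exact ⟨α, δ, ε, θ, rfl⟩

theorem cElt_one : cElt (0 : F) 0 0 1 = 1 := Subtype.ext cMatrix_one

theorem wElt_mul (α δ α' δ' : F) : wElt α δ * wElt α' δ' = wElt (α + α') (δ + δ') := by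
  rw [wElt, wElt, cElt_mul, wElt]; congr 1 <;> simp

theorem wElt_zero : wElt (0 : F) 0 = 1 := cElt_one

theorem wElt_injective {α δ α' δ' : F} (h : wElt α δ = wElt α' δ') : α = α' ∧ δ = δ' :=
  ⟨(cElt_injective h).1, (cElt_injective h).2.1⟩

theorem wElt_pow_p [CharP F p] (α δ : F) : wElt α δ ^ p = 1 := by
  apply Subtype.ext
  rw [Subgroup.coe_pow]
  refine (cMatrix_pow_unip α δ p).trans ?_
  rw [CharP.cast_eq_zero, zero_mul, zero_mul]
  exact cMatrix_one

theorem wElt_inv (α δ : F) : (wElt α δ)⁻¹ = wElt (-α) (-δ) := by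
  rw [inv_eq_iff_mul_eq_one, wElt_mul, add_neg_cancel, add_neg_cancel, wElt_zero]

/-- An embedding of `C` in a group `G` whose image contains the normalizer of the image of `W`
(for finite `G`). -/
structure IsNormalizerEmbedding {G : Type*} [Group G] (φ : subC F →* G) : Prop where
  injective : Function.Injective φ
  mem_range : ∀ g : G, (∀ α δ, ∃ α' δ', g * φ (wElt α δ) * g⁻¹ = φ (wElt α' δ')) → ∃ c, φ c = g

theorem IsNormalizerEmbedding.conj {G : Type*} [Group G] {φ : subC F →* G}
    (hφ : IsNormalizerEmbedding φ) (g : G) :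
    IsNormalizerEmbedding ((MulAut.conj g).toMonoidHom.comp φ) where
  injective := (MulAut.conj g).injective.comp hφ.injective
  mem_range x hx := by
    obtain ⟨c, hc⟩ := hφ.mem_range (g⁻¹ * x * g) fun α δ => by
      obtain ⟨α', δ', h⟩ := hx α δ
      refine ⟨α', δ', (MulAut.conj g).injective ?_⟩
      refine Eq.trans ?_ h
      simp only [MulAut.conj_apply, MonoidHom.comp_apply, MulEquiv.coe_toMonoidHom]
      group
    refine ⟨c, ?_⟩
    simp only [MulAut.conj_apply, MonoidHom.comp_apply, MulEquiv.coe_toMonoidHom, hc]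
    group

variable [CharP F p] {hm : m < p} [Finite F]

theorem not_dvd_index_sylowP (hp : p.Prime) : ¬ p ∣ (sylowP F hm).index := by
  have : Fact p.Prime := ⟨hp⟩
  have := Fintype.ofFinite F
  obtain ⟨n, -, hn⟩ := FiniteField.card F p
  have hidx : (sylowP F hm).index = (unipHom F).range.index :=
    Subgroup.index_comap_of_surjective _ SemidirectProduct.rightHom_surjective
  have hr : Nat.card (unipHom F).range = Fintype.card F := by
    rw [← Nat.card_congr (MonoidHom.ofInjective unipHom_injective).toEquiv,
      ← Nat.card_eq_fintype_card]
    exact Nat.card_congr Multiplicative.toAdd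
  have hL : Nat.card (L F) = (Fintype.card F - 1) *
      ((Fintype.card F ^ 2 - 1) * (Fintype.card F ^ 2 - Fintype.card F)) := by
    rw [Nat.card_prod, Nat.card_units, Matrix.card_GL_field, Fin.prod_univ_two,
      Nat.card_eq_fintype_card]
    simp
  have hq0 : 0 < Fintype.card F := Fintype.card_pos
  have hmul := (unipHom F).range.card_mul_index
  have hpq : p ∣ Fintype.card F := by rw [hn]; exact dvd_pow_self p n.pos.ne'
  rw [hr, hL, show Fintype.card F ^ 2 - Fintype.card F =
    Fintype.card F * (Fintype.card F - 1) by rw [Nat.mul_sub, mul_one, sq]] at hmul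
  have hi : (unipHom F).range.index =
      (Fintype.card F - 1) * ((Fintype.card F ^ 2 - 1) * (Fintype.card F - 1)) := by
    apply Nat.eq_of_mul_eq_mul_left hq0
    rw [hmul]; ring
  have h1 : ∀ s : ℕ, s ≠ 0 → ¬ p ∣ Fintype.card F ^ s - 1 := by
    intro s hs hd
    have h2 : p ∣ Fintype.card F ^ s := hpq.trans (dvd_pow_self _ hs)
    have h3 := (Nat.dvd_sub h2 hd)
    rw [Nat.sub_sub_self (Nat.one_le_pow _ _ hq0)] at h3
    exact hp.one_lt.ne' (Nat.dvd_one.1 h3)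
  have h2 := h1 1 one_ne_zero
  rw [pow_one] at h2
  rw [hidx, hi, hp.dvd_mul, hp.dvd_mul]
  rintro (h | h | h)
  exacts [h2 h, h1 2 two_ne_zero h, h2 h]

/-- By Sylow's theorem the image of `W` may be conjugated into the image of the subgroup of the
elements of `P` with unipotent lower triangular part. -/
theorem exists_normalizerEmbedding (hp : p.Prime) {W₀ : Subgroup (P F hm ⧸ CLQ F hm)}
    {e : normBar W₀ ≃* subC F} (he : imageUnder W₀ e = subW F p) :
    ∃ φ : subC F →* P F hm ⧸ Subgroup.center (P F hm), IsNormalizerEmbedding φ ∧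
      ∀ α δ, φ (wElt α δ) ∈
        (sylowP F hm).map (QuotientGroup.mk' (Subgroup.center (P F hm))) := by
  have : Fact p.Prime := ⟨hp⟩
  set φ : subC F →* P F hm ⧸ Subgroup.center (P F hm) :=
    (normBar W₀).subtype.comp e.symm.toMonoidHom with hφ
  have hφe : ∀ c, φ c = (e.symm c).1 := fun _ => rfl
  have hmem : ∀ y, y ∈ modCenter W₀ ↔ ∃ α δ, y = φ (wElt α δ) := by
    intro y
    constructor
    · intro hy
      have hyN : y ∈ normBar W₀ := Subgroup.le_normalizer hy
      have h1 : (e ⟨y, hyN⟩).1 ∈ subW F p := by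
        rw [← he, mem_imageUnder_iff]; exact ⟨_, hy, rfl⟩
      obtain ⟨α, δ, h2⟩ := (mem_subW_iff hp _).1 h1
      refine ⟨α, δ, ?_⟩
      have h3 : e ⟨y, hyN⟩ = wElt α δ := Subtype.ext h2
      rw [hφe, ← h3, MulEquiv.symm_apply_apply]
    · rintro ⟨α, δ, rfl⟩
      have h1 : cMatrix α δ 0 1 ∈ imageUnder W₀ e := by
        rw [he, mem_subW_iff hp]; exact ⟨α, δ, rfl⟩
      obtain ⟨y, hy, hye⟩ := mem_imageUnder_iff.1 h1
      have h3 : e y = wElt α δ := Subtype.ext hye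
      rwa [hφe, ← h3, MulEquiv.symm_apply_apply]
  have hemb : IsNormalizerEmbedding φ := by
    refine ⟨Subtype.val_injective.comp e.symm.injective, fun g hg => ?_⟩
    have hgN : g ∈ normBar W₀ := by
      refine Subgroup.mem_normalizer_fintype fun y hy => ?_
      obtain ⟨α, δ, rfl⟩ := (hmem y).1 hy
      exact (hmem _).2 (hg α δ)
    exact ⟨e ⟨g, hgN⟩, by rw [hφe, MulEquiv.symm_apply_apply]⟩
  have hWp : IsPGroup p (modCenter W₀) := by
    rintro ⟨y, hy⟩
    obtain ⟨α, δ, rfl⟩ := (hmem y).1 hy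
    exact ⟨1, Subtype.ext (by
      rw [Subgroup.coe_pow, pow_one, ← map_pow, wElt_pow_p, map_one]; rfl)⟩
  have hSp : IsPGroup p (sylowP F hm) := fun x =>
    ⟨3, Subtype.ext (pow_eq_one_of_mem_sylowP x.2)⟩
  have hidx : ¬ p ∣ ((sylowP F hm).map
      (QuotientGroup.mk' (Subgroup.center (P F hm)))).index := fun h =>
    not_dvd_index_sylowP (hm := hm) hp
      (h.trans (Subgroup.index_map_dvd _ (QuotientGroup.mk'_surjective _)))
  let S := (hSp.map (QuotientGroup.mk' (Subgroup.center (P F hm)))).toSylow hidx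
  obtain ⟨R, hR⟩ := hWp.exists_le_sylow
  obtain ⟨g, hg⟩ := MulAction.exists_smul_eq (P F hm ⧸ Subgroup.center (P F hm)) R S
  refine ⟨_, hemb.conj g, fun α δ => ?_⟩
  have h1 : φ (wElt α δ) ∈ R := hR ((hmem _).2 ⟨α, δ, rfl⟩)
  have h2 : MulAut.conj g (φ (wElt α δ)) ∈ g • R := Subgroup.smul_mem_pointwise_smul _ _ _ h1
  rw [hg] at h2
  exact h2

end reduction

/-! ### Embeddings of `C` with normalizing image -/

section necessity

variable {F : Type*} [Field F] {p m : ℕ} [CharP F p] {hm : m < p}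

local notation "mkZ" => QuotientGroup.mk' (Subgroup.center (P F hm))

theorem inl_center_comm (z γ : F) (x : Q F m) :
    elt hm 1 ⟨0, z⟩ * elt hm (1, lower 1 1 γ) x = elt hm (1, lower 1 1 γ) x * elt hm 1 ⟨0, z⟩ := by
  rw [elt_mul, elt_mul, one_mul, mul_one, rightAct_one]
  congr 1
  apply Q.ext <;> simp [add_comm]

theorem rightAct_unip_monoX (γ τ z : F) :
    rightAct (1, lower 1 1 γ) (⟨monoX m τ, z⟩ : Q F m) = ⟨monoX m τ, z⟩ := by
  apply Q.ext
  · rw [rightAct_v, act_monoX_of_unipotent, Units.val_one, one_smul]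
  · simp

/-- The commutator of `τ X^m` with an element of the Sylow subgroup. -/
theorem elt_monoX_mul (hodd : Odd m) (τ z γ : F) (x : Q F m) :
    elt hm 1 ⟨monoX m τ, z⟩ * elt hm (1, lower 1 1 γ) x =
      elt hm (1, lower 1 1 γ) x * elt hm 1 ⟨0, -2 * τ * coeffY F m x.v⟩ *
        elt hm 1 ⟨monoX m τ, z⟩ := by
  rw [elt_mul, elt_mul, elt_mul, one_mul, mul_one, mul_one, rightAct_one, rightAct_one,
    rightAct_unip_monoX]
  congr 1
  apply Q.ext
  · rw [Q.mul_v, Q.mul_v, Q.mul_v, add_zero, add_comm]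
  · rw [Q.mul_z, Q.mul_z, Q.mul_z, Q.mul_v, form_monoX_left hodd, map_zero, add_zero,
      add_zero, form_monoX_right]
    ring

theorem elt_mem_sylowP (γ : F) (x : Q F m) : elt hm (1, lower 1 1 γ) x ∈ sylowP F hm :=
  mem_sylowP.2 ⟨γ, x, rfl⟩

theorem elt_one_mem_sylowP (x : Q F m) : elt hm 1 x ∈ sylowP F hm :=
  mem_sylowP.2 ⟨0, x, by rw [unip_zero]⟩

/-- The Sylow subgroup embeds in the quotient of `P` by its centre. -/
theorem eq_of_mkZ_eq (hp2 : p ≠ 2) (hodd : Odd m) {x y : P F hm} {k : ℕ} (hx : x ^ p ^ k = 1)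
    (hy : y ^ p ^ k = 1) (h : mkZ x = mkZ y) : x = y :=
  eq_of_mk_eq (fun _ hz _ hk => eq_one_of_mem_center hp2 hodd hz hk) hx hy h

theorem eq_of_mem_sylowP (hp2 : p ≠ 2) (hodd : Odd m) {x y : P F hm} (hx : x ∈ sylowP F hm)
    (hy : y ∈ sylowP F hm) (h : mkZ x = mkZ y) : x = y :=
  eq_of_mkZ_eq hp2 hodd (pow_eq_one_of_mem_sylowP hx) (pow_eq_one_of_mem_sylowP hy) h

/-- In `C`, the subgroup `W` is its own centralizer. -/
theorem exists_eq_wElt_of_comm {c : subC F} (h : c * wElt 1 0 = wElt 1 0 * c) :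
    ∃ α δ, c = wElt α δ := by
  obtain ⟨α, δ, ε, θ, rfl⟩ := exists_eq_cElt c
  rw [wElt, cElt_mul, cElt_mul] at h
  obtain ⟨h1, h2, -, -⟩ := cElt_injective h
  have hθ : θ = 1 := by
    apply Units.ext
    simp only [Units.val_one, one_mul, mul_one] at h1 ⊢
    linear_combination h1
  have hε : ε = 0 := by
    subst hθ
    simpa using h2
  exact ⟨α, δ, by rw [hθ, hε]; rfl⟩

/-- An element of order at most two of `C` that centralizes a nontrivial element of `W` is trivial:
involutions of `C` act on `W` with no eigenvalue `1`. -/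
theorem eq_one_of_sq_eq_one (h2 : (2 : F) ≠ 0) {c : subC F} (hc : c * c = 1) {α δ : F}
    (h0 : ¬ (α = 0 ∧ δ = 0)) (h : c * wElt α δ = wElt α δ * c) : c = 1 := by
  obtain ⟨α', δ', ε, θ, rfl⟩ := exists_eq_cElt c
  rw [wElt, cElt_mul, cElt_mul] at h
  obtain ⟨h1, h3, -, -⟩ := cElt_injective h
  rw [cElt_mul, ← cElt_one] at hc
  obtain ⟨h4, h5, h6, h7⟩ := cElt_injective hc
  have hθ : θ = 1 := by
    by_contra hne
    have hne' : (θ : F) - 1 ≠ 0 := fun hh => hne (Units.ext (sub_eq_zero.1 hh))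
    have hα : α = 0 := by
      simp only [Units.val_one, one_mul] at h1
      have : ((θ : F) - 1) * α = 0 := by linear_combination h1
      exact (mul_eq_zero.1 this).resolve_left hne'
    have hδ : δ = 0 := by
      have hi : θ⁻¹ = θ := inv_eq_iff_mul_eq_one.2 h7
      simp only [hα, hi, mul_zero, add_zero, zero_mul, inv_one, Units.val_one, one_mul] at h3
      have : ((θ : F) - 1) * δ = 0 := by linear_combination h3
      exact (mul_eq_zero.1 this).resolve_left hne'
    exact h0 ⟨hα, hδ⟩
  subst hθ
  simp only [inv_one, Units.val_one, one_mul, mul_one] at h4 h5 h6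
  have ha : α' = 0 := (mul_eq_zero.1 (show 2 * α' = 0 by linear_combination h4)).resolve_left h2
  have he : ε = 0 := (mul_eq_zero.1 (show 2 * ε = 0 by linear_combination h6)).resolve_left h2
  rw [ha, mul_zero, add_zero] at h5
  have hd : δ' = 0 := (mul_eq_zero.1 (show 2 * δ' = 0 by linear_combination h5)).resolve_left h2
  rw [ha, he, hd, cElt_one]

variable {φ : subC F →* P F hm ⧸ Subgroup.center (P F hm)}

theorem mkZ_mem_of_comm (hφ : IsNormalizerEmbedding φ) {x : P F hm}
    (h : ∀ α δ, mkZ x * φ (wElt α δ) = φ (wElt α δ) * mkZ x) : ∃ α δ, mkZ x = φ (wElt α δ) := by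
  obtain ⟨c, hc⟩ := hφ.mem_range (mkZ x) fun α δ => ⟨α, δ, by rw [h, mul_inv_cancel_right]⟩
  obtain ⟨α, δ, rfl⟩ := exists_eq_wElt_of_comm (c := c) (hφ.injective (by
    rw [map_mul, map_mul, hc, h]))
  exact ⟨α, δ, hc.symm⟩

/-- The image of `W` contains the centre `{(0, z)}` of `Q`, since it is self-centralizing. -/
theorem exists_centre_eq (hφ : IsNormalizerEmbedding φ)
    (hS : ∀ α δ, ∃ γ x, φ (wElt α δ) = mkZ (elt hm (1, lower 1 1 γ) x)) (z : F) :
    ∃ α δ, mkZ (elt hm 1 ⟨0, z⟩) = φ (wElt α δ) := by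
  refine mkZ_mem_of_comm hφ fun α δ => ?_
  obtain ⟨γ, x, h⟩ := hS α δ
  rw [h, ← map_mul, inl_center_comm, map_mul]

/-- The image of `W` is not contained in `Q`. Otherwise it is normalized by `s = (-1, I)`, which
inverts `Q` modulo its centre and centralizes the latter; but `C` has no such involution. -/
theorem exists_unipotent_ne_zero (hp2 : p ≠ 2) (hodd : Odd m) (hφ : IsNormalizerEmbedding φ)
    (hS : ∀ α δ, ∃ γ x, φ (wElt α δ) = mkZ (elt hm (1, lower 1 1 γ) x)) :
    ∃ α δ γ x, φ (wElt α δ) = mkZ (elt hm (1, lower 1 1 γ) x) ∧ γ ≠ 0 := by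
  have h2 : (2 : F) ≠ 0 := two_ne_zero_of_char hp2
  by_contra! hcon
  have hQ : ∀ α δ, ∃ x, φ (wElt α δ) = mkZ (elt hm 1 x) := by
    intro α δ
    obtain ⟨γ, x, h⟩ := hS α δ
    have := hcon _ _ _ _ h
    subst this
    exact ⟨x, by rw [h, unip_zero]⟩
  set s : P F hm := elt hm (-1, 1) 1 with hs
  have hs2 : s * s = 1 := by
    rw [hs, elt_mul, ← elt_one]
    congr 1
    · simp
    · apply Q.ext <;> simp
  have hconj : ∀ x : Q F m, s * elt hm 1 x = elt hm 1 (⟨-x.v, x.z⟩) * s := by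
    intro x
    rw [hs, elt_mul, elt_mul, one_mul, mul_one]
    congr 1
    apply Q.ext
    · simp [act_one]
    · simp
  obtain ⟨c, hc⟩ := hφ.mem_range (mkZ s) fun α δ => by
    obtain ⟨x, hx⟩ := hQ α δ
    obtain ⟨α', δ', hz⟩ := exists_centre_eq hφ hS (2 * x.z - form F m x.v x.v)
    refine ⟨-α + α', -δ + δ', ?_⟩
    have hmul : elt hm 1 ⟨-x.v, x.z⟩ * elt hm 1 x =
        elt hm 1 ⟨0, 2 * x.z - form F m x.v x.v⟩ := by
      rw [elt_mul, one_mul, rightAct_one]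
      congr 1
      apply Q.ext
      · simp
      · simp; ring
    rw [← wElt_mul, ← wElt_inv, map_mul, map_inv, ← hz, hx, ← map_mul, hconj, map_mul,
      mul_inv_cancel_right, eq_inv_mul_iff_mul_eq, ← map_mul, ← hmul]
    have hcomm : elt hm 1 x * elt hm 1 ⟨-x.v, x.z⟩ = elt hm 1 ⟨-x.v, x.z⟩ * elt hm 1 x := by
      rw [elt_mul, elt_mul, one_mul, rightAct_one, rightAct_one]
      congr 1
      apply Q.ext <;> simp [add_comm]
    rw [hcomm]
  obtain ⟨α, δ, h1⟩ := exists_centre_eq hφ hS 1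
  have hne : ¬ (α = 0 ∧ δ = 0) := by
    rintro ⟨rfl, rfl⟩
    rw [wElt_zero, map_one, ← map_one mkZ] at h1
    have := eq_of_mem_sylowP hp2 hodd (elt_one_mem_sylowP _) (one_mem _) h1
    rw [← elt_one] at this
    exact one_ne_zero (congrArg Q.z (elt_injective this).2)
  have hc1 : c = 1 := by
    refine eq_one_of_sq_eq_one h2 (hφ.injective ?_) hne (hφ.injective ?_)
    · rw [map_mul, hc, ← map_mul, hs2, map_one, map_one]
    · rw [map_mul, map_mul, hc, ← h1, ← map_mul, ← map_mul, hconj]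
      simp
  rw [hc1, map_one] at hc
  have hsc : s ∈ Subgroup.center (P F hm) := (QuotientGroup.eq_one_iff _).1 hc.symm
  have h3 := (Subgroup.mem_center_iff.1 hsc) (elt hm 1 ⟨monoX m 1, 0⟩)
  rw [hconj] at h3
  have h4 := congrArg Q.v (elt_injective (mul_right_cancel h3)).2
  have h5 : monoX m (1 : F) = monoX m (-1) := by
    refine h4.trans ?_
    change -monoX m (1 : F) = _
    rw [← neg_one_smul F, smul_monoX, mul_one]
  have h6 := monoX_injective h5
  exact h2 (by linear_combination h6)

theorem mkZ_monoX_conj (hodd : Odd m) (hφ : IsNormalizerEmbedding φ)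
    (hS : ∀ α δ, ∃ γ x, φ (wElt α δ) = mkZ (elt hm (1, lower 1 1 γ) x)) (τ z : F) :
    ∃ c, φ c = mkZ (elt hm 1 ⟨monoX m τ, z⟩) := by
  refine hφ.mem_range _ fun α δ => ?_
  obtain ⟨γ, x, h⟩ := hS α δ
  obtain ⟨α', δ', hz⟩ := exists_centre_eq hφ hS (-2 * τ * coeffY F m x.v)
  refine ⟨α + α', δ + δ', ?_⟩
  rw [h, ← map_mul, elt_monoX_mul hodd, map_mul, mul_inv_cancel_right, map_mul, ← h, hz,
    ← map_mul, wElt_mul]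

/-- Some element of the image of `W` does not commute with `X^m`. Otherwise all `(τ X^m, z)` lie
in the image of `W`, and they exhaust it since `|W| = |F|²`; but it is not contained in `Q`. -/
theorem exists_coeffY_ne_zero [Finite F] (hp2 : p ≠ 2) (hodd : Odd m)
    (hφ : IsNormalizerEmbedding φ)
    (hS : ∀ α δ, ∃ γ x, φ (wElt α δ) = mkZ (elt hm (1, lower 1 1 γ) x)) :
    ∃ α δ γ x, φ (wElt α δ) = mkZ (elt hm (1, lower 1 1 γ) x) ∧ coeffY F m x.v ≠ 0 := by
  by_contra! hcon
  have hall : ∀ t : F × F, ∃ u : F × F, mkZ (elt hm 1 ⟨monoX m t.1, t.2⟩) =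
      φ (wElt u.1 u.2) := by
    intro t
    obtain ⟨α, δ, h⟩ := mkZ_mem_of_comm hφ (x := elt hm 1 ⟨monoX m t.1, t.2⟩) fun α δ => by
      obtain ⟨γ, x, h⟩ := hS α δ
      rw [h, ← map_mul, elt_monoX_mul hodd, hcon _ _ _ _ h, mul_zero,
        show (⟨0, 0⟩ : Q F m) = 1 from rfl, elt_one, mul_one, map_mul]
    exact ⟨(α, δ), h⟩
  choose c hc using hall
  have hinj : Function.Injective c := by
    intro t t' htt
    have h := hc t
    rw [htt, ← hc t'] at h
    have h1 := eq_of_mem_sylowP hp2 hodd (elt_one_mem_sylowP _) (elt_one_mem_sylowP _) h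
    have h2 := (elt_injective h1).2
    exact Prod.ext (monoX_injective (congrArg Q.v h2)) (congrArg Q.z h2)
  obtain ⟨α, δ, γ, x, h, hγ⟩ := exists_unipotent_ne_zero hp2 hodd hφ hS
  obtain ⟨t, ht⟩ := Finite.surjective_of_injective hinj (α, δ)
  have h1 := hc t
  rw [ht, h] at h1
  have h2 := eq_of_mem_sylowP hp2 hodd (elt_one_mem_sylowP _) (elt_mem_sylowP _ _) h1
  have h3 := (elt_injective h2).1
  rw [← unip_zero] at h3
  exact hγ (lower_injective (congrArg Prod.snd h3)).2.2.symm

/-- The functional `coeffY` on the image of `W` detects the coordinate `α`: both describe the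
elements that commute with `X^m`, whose preimage in `C` has `θ = 1` and `ε ≠ 0`. -/
theorem coeffY_eq_zero_iff [Finite F] (hp2 : p ≠ 2) (hodd : Odd m)
    (hφ : IsNormalizerEmbedding φ)
    (hS : ∀ α δ, ∃ γ x, φ (wElt α δ) = mkZ (elt hm (1, lower 1 1 γ) x)) {α δ γ : F} {x : Q F m}
    (h : φ (wElt α δ) = mkZ (elt hm (1, lower 1 1 γ) x)) : coeffY F m x.v = 0 ↔ α = 0 := by
  have h2 : (2 : F) ≠ 0 := two_ne_zero_of_char hp2
  obtain ⟨c, hc⟩ := mkZ_monoX_conj hodd hφ hS 1 0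
  have hcomm : ∀ {α δ γ : F} {x : Q F m}, φ (wElt α δ) = mkZ (elt hm (1, lower 1 1 γ) x) →
      (coeffY F m x.v = 0 ↔ c * wElt α δ = wElt α δ * c) := by
    intro α δ γ x h
    rw [← hφ.injective.eq_iff, map_mul, map_mul, hc, h, ← map_mul, ← map_mul, elt_monoX_mul hodd]
    constructor
    · intro h0
      rw [h0, mul_zero, show (⟨0, 0⟩ : Q F m) = 1 from rfl, elt_one, mul_one]
    · intro h0
      rw [map_mul, map_mul, map_mul, mul_left_inj, mul_eq_left, ← map_one mkZ] at h0
      have h1 := eq_of_mem_sylowP hp2 hodd (elt_one_mem_sylowP _) (one_mem _) h0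
      rw [← elt_one] at h1
      have h3 : -2 * 1 * coeffY F m x.v = 0 := congrArg Q.z (elt_injective h1).2
      rw [mul_one, neg_mul, neg_eq_zero] at h3
      exact (mul_eq_zero.1 h3).resolve_left h2
  rw [hcomm h]
  obtain ⟨α₀, δ₀, γ₀, x₀, h0, hx0⟩ := exists_coeffY_ne_zero hp2 hodd hφ hS
  rw [Ne, hcomm h0] at hx0
  obtain ⟨αc, δc, ε, θ, rfl⟩ := exists_eq_cElt c
  have hpow : cElt αc δc ε θ ^ p ^ 3 = 1 := hφ.injective (by
    rw [map_pow, hc, ← map_pow, pow_eq_one_of_mem_sylowP (elt_one_mem_sylowP _), map_one, map_one])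
  have hθpow : ∀ n : ℕ, ∃ α δ ε', cElt αc δc ε θ ^ n = cElt α δ ε' (θ ^ n) := by
    intro n
    induction n with
    | zero => exact ⟨0, 0, 0, by rw [pow_zero, pow_zero, cElt_one]⟩
    | succ n ih =>
      obtain ⟨α, δ, ε', h⟩ := ih
      exact ⟨_, _, _, by rw [pow_succ, h, cElt_mul, ← pow_succ]⟩
  have hθ : θ = 1 := by
    obtain ⟨_, _, _, h3⟩ := hθpow (p ^ 3)
    rw [hpow, ← cElt_one] at h3
    have h4 := (cElt_injective h3).2.2.2
    exact Units.ext (eq_one_of_pow_p_pow_eq_one hm (k := 3)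
      (by rw [← Units.val_pow_eq_pow_val, ← h4, Units.val_one]))
  subst hθ
  have key : ∀ α δ, cElt αc δc ε 1 * wElt α δ = wElt α δ * cElt αc δc ε 1 ↔ ε * α = 0 := by
    intro α δ
    rw [wElt, cElt_mul, cElt_mul]
    simp only [inv_one, Units.val_one, one_mul, mul_one, zero_mul, add_zero, zero_add]
    constructor
    · intro h
      linear_combination (cElt_injective h).2.1
    · intro h
      rw [h]; congr 1 <;> ring
  rw [key] at hx0 ⊢
  rw [mul_eq_zero, or_iff_right (left_ne_zero_of_mul hx0)]

/-! ### The arithmetic condition -/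

theorem act_unip_of_one (γ : F) (v : V F 1) :
    act (lower 1 1 γ).1 v = v + monoX 1 (γ * coeffY F 1 v) := by
  obtain ⟨s, t, rfl⟩ : ∃ s t, v = linPow 1 s t := by
    refine ⟨MvPolynomial.coeff (expo 1 0) v.1, MvPolynomial.coeff (expo 0 1) v.1, Subtype.ext ?_⟩
    rw [linPow_eq]
    refine (eq_sum v).trans ?_
    simp [Finset.sum_range_succ, add_comm]
  rw [act_linPow]
  have hc : coeffY F 1 (linPow 1 s t) = t := by
    rw [coeffY_eq_eval, eval_linPow]; simp
  rw [hc]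
  apply Subtype.ext
  rw [Submodule.coe_add, monoX_eq]
  simp only [linPow, lower_zero_zero, lower_zero_one, lower_one_zero, lower_one_one, map_mul,
    map_add, pow_one, Units.val_one, mul_one, mul_zero, zero_add]
  ring

/-- For `p = 3` and `m = 1`, elements of order `3` outside `Q` do not involve `Y`. -/
theorem cube_ne_one {hm : 1 < p} (hp3 : p = 3) {γ : F} (hγ : γ ≠ 0) {x : Q F 1}
    (hx : coeffY F 1 x.v ≠ 0) : elt hm (1, lower 1 1 γ) x ^ 3 ≠ 1 := by
  intro h
  have h3 : (3 : F) = 0 := by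
    have := CharP.cast_eq_zero F p
    rw [hp3] at this
    exact_mod_cast this
  have hself : form F 1 x.v x.v = 0 := by
    rw [form_apply]
    simp [Finset.sum_range_succ]
    ring
  rw [pow_succ, pow_two, elt_mul, elt_mul, ← elt_one] at h
  have hz := congrArg Q.z (elt_injective h).2
  have hc : ∀ τ : F, coeffY F 1 (monoX 1 τ) = 0 := coeffY_monoX one_ne_zero
  simp only [Q.mul_z, Q.mul_v, rightAct_z, rightAct_v, Units.val_one, one_smul, act_unip_of_one,
    map_add, hc, det_lower, LinearMap.add_apply, form_monoX_left odd_one, hself, Q.one_z] at hz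
  have h4 : γ * coeffY F 1 x.v * coeffY F 1 x.v = 0 := by
    linear_combination -hz + x.z * h3 - (γ * coeffY F 1 x.v * coeffY F 1 x.v) * h3
  exact mul_ne_zero (mul_ne_zero hγ hx) hx h4

/-- If an element `h = (t, A) y` of `P` conjugates one element of the Sylow subgroup outside `Q`
to another, then `A` is lower triangular, with diagonal entries `a` and `b`, and conjugation by
`h` multiplies `γ` by `b / a` and the coefficient of `Y^m` by `(t b^m)⁻¹`. -/
theorem conj_unip_coords {l : L F} {y x x' : Q F m} {γ γ' : F} (hγ : γ ≠ 0)
    (h : elt hm l y * elt hm (1, lower 1 1 γ) x = elt hm (1, lower 1 1 γ') x' * elt hm l y) :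
    l.2.1 0 1 = 0 ∧ γ' * l.2.1 0 0 = l.2.1 1 1 * γ ∧
      coeffY F m x.v = (l.1 : F) * l.2.1 1 1 ^ m * coeffY F m x'.v := by
  rw [elt_mul, elt_mul] at h
  obtain ⟨h1, h2⟩ := elt_injective h
  have hA : l.2 * lower 1 1 γ = lower 1 1 γ' * l.2 := congrArg Prod.snd h1
  have h01 := zero_one_of_conj hγ hA
  obtain ⟨t, A⟩ := l
  obtain ⟨a, b, c, rfl⟩ := eq_lower A h01
  refine ⟨h01, ?_, ?_⟩
  · simp only [lower_mul, one_mul, mul_one] at hA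
    have h3 := (lower_injective hA).2.2
    simp only [lower_zero_zero, lower_one_one, Units.val_one, mul_one, one_mul] at h3 ⊢
    linear_combination -h3
  · have h3 := congrArg (fun q : Q F m => coeffY F m q.v) h2
    simp only [Q.mul_v, rightAct_v, map_add, map_smul, coeffY_act_lower, smul_eq_mul,
      Units.val_one, one_pow, one_mul] at h3
    simp only [lower_one_one]
    linear_combination h3

theorem elt_mul_centre (l : L F) (y : Q F m) (z : F) :
    elt hm l y * elt hm 1 ⟨0, (l.1 : F) ^ 2 * l.2.1.det ^ m * z⟩ = elt hm 1 ⟨0, z⟩ * elt hm l y := by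
  rw [elt_mul, elt_mul, one_mul, mul_one, rightAct_one]
  congr 1
  apply Q.ext
  · simp
  · simp [add_comm]

/-- Write the element of the image of `W` with coordinates `(α, δ)` as `(1, u_γ) (v, z)`, where
`u_γ` is unipotent. The maps `α ↦ γ`, `α ↦ (coefficient of Y^m in v)` and the coordinate `δ` of
`(0, z)` are nonzero additive maps. They intertwine the conjugation by the diagonal element
`(1, θ, θ⁻¹)` of `C`, with `θ` a generator of `F^×`, and the conjugation by a corresponding element
`(t, A) y` of `P`. If `a, b` is the diagonal of `A`, then `b / a` and `(t b^m)⁻¹` are conjugate to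
`θ`, and so is `t² (a b)^m`. Hence `x = b / a` satisfies `x^m (x^(p^j))² x^(p^k) = 1`
for some `j` and `k`. -/
theorem card_eq_of_normalizerEmbedding [Finite F] (hp : p.Prime) (hp2 : p ≠ 2) (hodd : Odd m)
    (hφ : IsNormalizerEmbedding φ)
    (hS : ∀ α δ, ∃ γ x, φ (wElt α δ) = mkZ (elt hm (1, lower 1 1 γ) x)) :
    Nat.card F = p ∧ p = m + 4 := by
  have hpodd : Odd p := hp.odd_of_ne_two hp2
  have hm1 : m + 1 < p := by
    obtain ⟨i, hi⟩ := hodd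
    obtain ⟨j, hj⟩ := hpodd
    omega
  choose γ x hγx using hS
  have hS : ∀ α δ, ∃ γ x, φ (wElt α δ) = mkZ (elt hm (1, lower 1 1 γ) x) :=
    fun α δ => ⟨_, _, hγx α δ⟩
  have hcY : ∀ α δ, coeffY F m (x α δ).v = 0 ↔ α = 0 := fun α δ =>
    coeffY_eq_zero_iff hp2 hodd hφ hS (hγx α δ)
  have hmul : ∀ α δ α' δ', elt hm (1, lower 1 1 (γ (α + α') (δ + δ'))) (x (α + α') (δ + δ')) =
      elt hm (1, lower 1 1 (γ α δ)) (x α δ) * elt hm (1, lower 1 1 (γ α' δ')) (x α' δ') := by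
    intro α δ α' δ'
    refine eq_of_mem_sylowP hp2 hodd (elt_mem_sylowP _ _)
      (mul_mem (elt_mem_sylowP _ _) (elt_mem_sylowP _ _)) ?_
    rw [map_mul, ← hγx, ← hγx, ← hγx, ← map_mul, wElt_mul]
  -- the three additive maps
  let Γ : F →+ F := AddMonoidHom.mk' (fun α => γ α 0) fun α α' => by
    have h := hmul α 0 α' 0
    rw [elt_mul, unip_mul, add_zero] at h
    exact (lower_injective (congrArg Prod.snd (elt_injective h).1)).2.2
  let f : F →+ F := AddMonoidHom.mk' (fun α => coeffY F m (x α 0).v) fun α α' => by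
    have h := hmul α 0 α' 0
    rw [elt_mul, add_zero] at h
    have h2 := congrArg (fun q : Q F m => coeffY F m q.v) (elt_injective h).2
    simp only [Q.mul_v, rightAct_v, map_add, map_smul, coeffY_act_lower, smul_eq_mul,
      Units.val_one, one_pow, one_mul] at h2
    exact h2
  have hcentre : ∀ z, ∃ δ, mkZ (elt hm 1 ⟨0, z⟩) = φ (wElt 0 δ) := by
    intro z
    obtain ⟨α, δ, h⟩ := exists_centre_eq hφ hS z
    have h' := h.symm
    rw [← unip_zero] at h'
    have hα := (coeffY_eq_zero_iff hp2 hodd hφ hS h').1 (map_zero _)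
    exact ⟨δ, hα ▸ h⟩
  choose k hk using hcentre
  have hkinj : ∀ {z z'}, k z = k z' → z = z' := by
    intro z z' h
    have h1 := (hk z).trans (h ▸ (hk z').symm)
    exact congrArg Q.z (elt_injective
      (eq_of_mem_sylowP hp2 hodd (elt_one_mem_sylowP _) (elt_one_mem_sylowP _) h1)).2
  let κ : F →+ F := AddMonoidHom.mk' k fun z z' => by
    have h : elt hm 1 ⟨0, z + z'⟩ = elt hm 1 ⟨0, z⟩ * elt hm 1 ⟨0, z'⟩ := by
      rw [elt_mul, one_mul, rightAct_one]
      congr 1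
      apply Q.ext <;> simp
    have h1 := congrArg mkZ h
    rw [map_mul, hk, hk, hk, ← map_mul, wElt_mul] at h1
    exact (wElt_injective (hφ.injective h1)).2
  have hγ0 : ∀ α, α ≠ 0 → γ α 0 ≠ 0 := by
    intro α hα h0
    -- an element of `Q` commuting with a nontrivial unipotent element is a multiple of `X^m`
    obtain ⟨α₁, δ₁, γ₁, x₁, h₁, hγ₁⟩ := exists_unipotent_ne_zero hp2 hodd hφ hS
    have hcomm : elt hm (1, lower 1 1 (γ α 0)) (x α 0) * elt hm (1, lower 1 1 γ₁) x₁ =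
        elt hm (1, lower 1 1 γ₁) x₁ * elt hm (1, lower 1 1 (γ α 0)) (x α 0) := by
      refine eq_of_mem_sylowP hp2 hodd (mul_mem (elt_mem_sylowP _ _) (elt_mem_sylowP _ _))
        (mul_mem (elt_mem_sylowP _ _) (elt_mem_sylowP _ _)) ?_
      rw [map_mul, map_mul, ← hγx, ← h₁, ← map_mul, ← map_mul, wElt_mul, wElt_mul, add_comm,
        add_comm (0 : F)]
    rw [h0, elt_mul, elt_mul, unip_zero, rightAct_one] at hcomm
    have hv := congrArg Q.v (elt_injective hcomm).2
    simp only [Q.mul_v, rightAct_v, Units.val_one, one_smul] at hv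
    rw [add_comm] at hv
    obtain ⟨τ, hτ⟩ := eq_monoX_of_fixed hm hγ₁ (add_left_cancel hv)
    refine hα ((hcY α 0).1 ?_)
    rw [hτ, coeffY_monoX hodd.pos.ne']
  have hf0 : f ≠ 0 := fun h => one_ne_zero ((hcY 1 0).1 (DFunLike.congr_fun h 1))
  have hΓ0 : Γ ≠ 0 := fun h => hγ0 1 one_ne_zero (DFunLike.congr_fun h 1)
  have hκ0 : κ ≠ 0 := fun h => one_ne_zero (hkinj ((DFunLike.congr_fun h 1).trans
    (map_zero κ).symm))
  -- an element of `P` that corresponds to a diagonal element of `C` with generating entry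
  obtain ⟨θ, hθ⟩ := IsCyclic.exists_generator (α := Fˣ)
  have hd : ∀ α δ : F, cElt 0 0 0 θ * wElt α δ = wElt (θ * α) (((θ⁻¹ : Fˣ) : F) * δ) * cElt 0 0 0 θ := by
    intro α δ
    rw [wElt, wElt, cElt_mul, cElt_mul]
    congr 1 <;> simp
  obtain ⟨h, hh⟩ := QuotientGroup.mk'_surjective (Subgroup.center (P F hm)) (φ (cElt 0 0 0 θ))
  have hconj : ∀ α δ (g g' : P F hm), g ∈ sylowP F hm → g' ∈ sylowP F hm → mkZ g = φ (wElt α δ) →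
      mkZ g' = φ (wElt (θ * α) (((θ⁻¹ : Fˣ) : F) * δ)) → h * g = g' * h := by
    intro α δ g g' hg hg' h1 h2
    have h3 : h * g * h⁻¹ = g' := by
      refine eq_of_mkZ_eq (k := 3) hp2 hodd ?_ (pow_eq_one_of_mem_sylowP hg') ?_
      · rw [conj_pow, pow_eq_one_of_mem_sylowP hg, mul_one, mul_inv_cancel]
      · rw [map_mul, map_mul, map_inv, hh, h1, h2, ← map_mul, hd, map_mul, mul_inv_cancel_right]
    rw [← h3, inv_mul_cancel_right]
  obtain ⟨y, hy⟩ := eq_elt h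
  set l := h.right with hl
  have hcoord : ∀ α, α ≠ 0 → l.2.1 0 1 = 0 ∧ γ (θ * α) 0 * l.2.1 0 0 = l.2.1 1 1 * γ α 0 ∧
      coeffY F m (x α 0).v = (l.1 : F) * l.2.1 1 1 ^ m * coeffY F m (x (θ * α) 0).v := by
    intro α hα
    refine conj_unip_coords (hm := hm) (y := y) (hγ0 α hα) ?_
    rw [← hy]
    refine hconj α 0 _ _ (elt_mem_sylowP _ _) (elt_mem_sylowP _ _) (hγx _ _).symm ?_
    rw [mul_zero, hγx]
  obtain ⟨a, b, c, hA⟩ := eq_lower l.2 (hcoord 1 one_ne_zero).1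
  have ha : (a : F) ≠ 0 := a.ne_zero
  have hb : (b : F) ≠ 0 := b.ne_zero
  have ht : (l.1 : F) ≠ 0 := l.1.ne_zero
  simp only [hA, lower_zero_zero, lower_one_one] at hcoord
  have hΓ : ∀ α, Γ (θ * α) = ((b : F) / a) * Γ α := by
    intro α
    by_cases hα : α = 0
    · rw [hα, mul_zero, map_zero, mul_zero]
    · have := (hcoord α hα).2.1
      change γ (θ * α) 0 = (b : F) / a * γ α 0
      field_simp
      linear_combination this
  have hf : ∀ α, f (θ * α) = ((l.1 : F) * b ^ m)⁻¹ * f α := by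
    intro α
    by_cases hα : α = 0
    · rw [hα, mul_zero, map_zero, mul_zero]
    · have := (hcoord α hα).2.2
      change coeffY F m (x (θ * α) 0).v = ((l.1 : F) * b ^ m)⁻¹ * coeffY F m (x α 0).v
      rw [this, inv_mul_cancel_left₀ (mul_ne_zero ht (pow_ne_zero _ hb))]
  have hκ : ∀ z, κ (((l.1 : F) ^ 2 * (a * b) ^ m) * z) = (θ : F) * κ z := by
    intro z
    have h1 := elt_mul_centre (hm := hm) l y z
    rw [← hy, hA, det_lower] at h1
    have h2 := hconj 0 (k ((l.1 : F) ^ 2 * (a * b) ^ m * z)) _ _ (elt_one_mem_sylowP _)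
      (elt_mem_sylowP _ _) (hk _) (hγx _ _).symm
    rw [h1, mul_left_inj] at h2
    have h3 := congrArg mkZ h2
    rw [hk, ← hγx] at h3
    have h4 := (wElt_injective (hφ.injective h3)).2
    change k _ = θ * k z
    rw [h4, Units.mul_inv_cancel_left]
  obtain ⟨-, i, hi⟩ := exists_frobenius_of_intertwines hp Γ hΓ0 hΓ
  obtain ⟨⟨j, hj⟩, -⟩ := exists_frobenius_of_intertwines hp f hf0 hf
  obtain ⟨-, r, hr⟩ := exists_frobenius_of_intertwines hp κ hκ0 hκ
  have hrel : ((b : F) / a) ^ m * ((((b : F) / a) ^ p ^ (i + j)) ^ 2) *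
      ((b : F) / a) ^ p ^ (i + r) = 1 := by
    rw [pow_add p, pow_mul, ← hi, ← hj, pow_add p, pow_mul, ← hi, ← hr, mul_pow (a : F), div_pow _ _ m]
    field_simp
  have hgen : ∀ n : ℕ, ((b : F) / a) ^ n = 1 → Nat.card F - 1 ∣ n := by
    intro n hn
    rw [← Nat.card_units, ← orderOf_eq_card_of_forall_mem_zpowers hθ]
    refine orderOf_dvd_of_pow_eq_one (Units.ext ?_)
    rw [Units.val_pow_eq_pow_val, hi, ← pow_mul, mul_comm, pow_mul, hn, one_pow, Units.val_one]
  by_cases hp5 : 5 ≤ p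
  · exact card_eq_of_pow_eq_one hp hp5 hm1 hgen hrel
  · exfalso
    have hp3 : p = 3 := by
      obtain ⟨j, rfl⟩ := hpodd
      have := hp.two_le
      omega
    obtain rfl : m = 1 := by
      obtain ⟨i, rfl⟩ := hodd
      omega
    refine cube_ne_one (hm := hm) hp3 (hγ0 1 one_ne_zero)
      (fun h => one_ne_zero ((hcY 1 0).1 h)) ?_
    refine eq_of_mem_sylowP hp2 odd_one (pow_mem (elt_mem_sylowP _ _) _) (one_mem _) ?_
    have h3 := wElt_pow_p (p := p) (1 : F) 0
    rw [hp3] at h3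
    rw [map_pow, ← hγx, ← map_pow, map_one, h3, map_one]

end necessity

end

end BinaryAmalgam

theorem theorem2p8 (p m : ℕ) (hp : p.Prime) (hp2 : p ≠ 2) (hmodd : Odd m) (hm : m < p)
    (F : Type*) [Field F] [Finite F] [CharP F p] :
    -- the equivalence
    ((∃ W₀ : Subgroup (BinaryAmalgam.P F hm ⧸ BinaryAmalgam.CLQ F hm), IsPGroup p W₀ ∧
        ∃ e : BinaryAmalgam.normBar W₀ ≃* BinaryAmalgam.subC F,
          BinaryAmalgam.imageUnder W₀ e = BinaryAmalgam.subW F p) ↔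
      Nat.card F = p ∧ p = m + 4) ∧
    -- in that case, the explicit subgroup, its normalizer and the explicit homomorphism
    (Nat.card F = p → p = m + 4 →
      IsPGroup p (BinaryAmalgam.W0 F hm) ∧
      (∀ x : BinaryAmalgam.P F hm, x ∈ BinaryAmalgam.normW0 F hm ↔
        ∃ (a b : Fˣ) (lam τ θ : F), x = BinaryAmalgam.nElt hm a b lam τ θ) ∧
      ∃ Θ : BinaryAmalgam.normW0 F hm →* BinaryAmalgam.subC F,
        (∀ (a b : Fˣ) (lam τ θ : F)
            (h : BinaryAmalgam.nElt hm a b lam τ θ ∈ BinaryAmalgam.normW0 F hm),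
          (Θ ⟨_, h⟩ : Matrix.SpecialLinearGroup (Fin 3) F) =
            BinaryAmalgam.thetaVal m a b lam τ θ) ∧
        Function.Surjective Θ ∧
        Θ.ker = (BinaryAmalgam.CLQ F hm).subgroupOf (BinaryAmalgam.normW0 F hm) ∧
        ∃ e : BinaryAmalgam.normBar (BinaryAmalgam.W0bar F hm) ≃* BinaryAmalgam.subC F,
          (∀ x : BinaryAmalgam.normW0 F hm,
            ∃ h : QuotientGroup.mk' (Subgroup.center (BinaryAmalgam.P F hm)) x.1 ∈
                BinaryAmalgam.normBar (BinaryAmalgam.W0bar F hm),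
              e ⟨_, h⟩ = Θ x) ∧
          BinaryAmalgam.imageUnder (BinaryAmalgam.W0bar F hm) e = BinaryAmalgam.subW F p) := by
  have hm1 : m + 1 < p := by
    obtain ⟨i, hi⟩ := hmodd
    obtain ⟨j, hj⟩ := hp.odd_of_ne_two hp2
    omega
  have hW0 : IsPGroup p (BinaryAmalgam.W0 F hm) := fun x =>
    ⟨3, Subtype.ext (BinaryAmalgam.pow_eq_one_of_mem_sylowP
      (BinaryAmalgam.W0_le_sylowP hm1 x.2))⟩
  refine ⟨⟨?_, ?_⟩, ?_⟩
  · rintro ⟨W₀, -, e, he⟩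
    obtain ⟨φ, hφ, hS⟩ := BinaryAmalgam.exists_normalizerEmbedding hp he
    refine BinaryAmalgam.card_eq_of_normalizerEmbedding hp hp2 hmodd hφ fun α δ => ?_
    obtain ⟨g, hg, hgφ⟩ := hS α δ
    obtain ⟨γ, x, rfl⟩ := BinaryAmalgam.mem_sylowP.1 hg
    exact ⟨γ, x, hgφ.symm⟩
  · rintro ⟨hcard, hpm⟩
    obtain ⟨Θ, hΘ⟩ := BinaryAmalgam.exists_theta (hm := hm) hpm hmodd hcard
    obtain ⟨e, -, he⟩ := BinaryAmalgam.exists_equiv_of_theta hp hp2 hmodd hm1 hΘ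
    exact ⟨BinaryAmalgam.W0bar F hm, hW0.map _, e, he⟩
  · intro hcard hpm
    obtain ⟨Θ, hΘ⟩ := BinaryAmalgam.exists_theta (hm := hm) hpm hmodd hcard
    exact ⟨hW0, BinaryAmalgam.mem_normW0_iff hm1, Θ, hΘ,
      BinaryAmalgam.theta_surjective hp2 hm1 hΘ, BinaryAmalgam.theta_ker hp2 hmodd hm1 hΘ,
      BinaryAmalgam.exists_equiv_of_theta hp hp2 hmodd hm1 hΘ⟩
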